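/- Let $\mathfrak m=\bigoplus_{p<0}\mathfrak g_p$ be a finite-dimensional real graded Lie algebra generated by its nonzero subspace $\mathfrak g_{-1}$ (a fundamental graded Lie algebra, FGLA), with $\mathfrak g_{-2}\neq 0$, and let $g$ be a nondegenerate symmetric bilinear form on $\mathfrak g_{-1}$, with conformal class $[g]=\{\eta g:\eta>0\}$. Let $\mathfrak g_0$ be the Lie algebra of all derivations $D$ of $\mathfrak m$ such that $D(\mathfrak g_p)\subset\mathfrak g_p$ for all $p<0$ and, for some $\eta_D\in\mathbb R$, $g(Dx,y)+g(x,Dy)=\eta_D\,g(x,y)$ for all $x,y\in\mathfrak g_{-1}$; let $\hat{\mathfrak g}_0\subset\mathfrak g_0$ be the subalgebra of those $D$ with $g(Dx,y)+g(x,Dy)=0$ for all $x,y\in\mathfrak g_{-1}$. The prolongation of $(\mathfrak m,[g])$ is the graded Lie algebra $\mathfrak g=\bigoplus_{p\in\mathbb Z}\mathfrak g_p$ whose part of degree $\le 0$ is $\mathfrak m\oplus\mathfrak g_0$, which is transitive (if $p\ge 0$, $X\in\mathfrak g_p$ and $[X,\mathfrak g_{-1}]=0$, then $X=0$), and which is maximal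 with these properties: for every $k\ge 1$, every linear map $\varphi:\mathfrak m\to\mathfrak g$ with $\varphi(\mathfrak g_p)\subset\mathfrak g_{p+k}$ for all $p<0$ and $\varphi([x,y])=[\varphi(x),y]+[x,\varphi(y)]$ for all $x,y\in\mathfrak m$ is $\operatorname{ad}(A)|_{\mathfrak m}$ for some $A\in\mathfrak g_k$. Assume that $(\mathfrak m,[g])$ is of semisimple type, i.e. that $\mathfrak g$ is finite-dimensional and semisimple. Write $V(\mathbb C)$ for the complexification of a real vector space $V$, and extend $g$ to a complex bilinear form on $\mathfrak g_{-1}(\mathbb C)$. A module $V$ is contragredient to a module $W$ if $V$ is isomorphic to the dual module $W^*$. Then: (1) If the $\mathfrak g_0(\mathbb C)$-module $\mathfrak g_{-1}(\mathbb C)$ is reducible (in particular, if it is reducible and the $\mathfrak g_0$-module $\mathfrak g_{-1}$ is irreducible), then there are irreducible $\mathfrak g_0(\mathbb C)$-submodules $\mathfrak g_{-1}(\mathbb C)^{(1)},\mathfrak g_{-1}(\mathbb C)^{(2)}$ with $\mathfrak g_{-1}(\mathbb C)=\mathfrak g_{-1}(\mathbb C)^{(1)}\oplus\mathfrak g_{-1}(\mathbb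 C)^{(2)}$, both totally isotropic with respect to $g$, such that $\mathfrak g_{-1}(\mathbb C)^{(1)}$ is contragredient to $\mathfrak g_{-1}(\mathbb C)^{(2)}$ as a $\hat{\mathfrak g}_0(\mathbb C)$-module. (2) If the $\mathfrak g_0$-module $\mathfrak g_{-1}$ is reducible, then there are $\mathfrak g_0$-submodules $\mathfrak g_{-1}^{(1)},\mathfrak g_{-1}^{(2)}$ with $\mathfrak g_{-1}=\mathfrak g_{-1}^{(1)}\oplus\mathfrak g_{-1}^{(2)}$, both totally isotropic with respect to $g$, such that $\mathfrak g_{-1}^{(1)}$ is contragredient to $\mathfrak g_{-1}^{(2)}$ as a $\hat{\mathfrak g}_0$-module and the $\mathfrak g_0(\mathbb C)$-modules $\mathfrak g_{-1}^{(i)}(\mathbb C)$ $(i=1,2)$ are irreducible. (3) $\mathfrak g$ is a simple graded Lie algebra of class (B): $\mathfrak g$ is simple, and it is a real form of a complex simple Lie algebra, such that $\mathfrak g(\mathbb C)=\bigoplus_{p\in\mathbb Z}\mathfrak g_p(\mathbb C)$ is a complex simple graded Lie algebra. -/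

import Mathlib

open scoped TensorProduct

namespace PseudoSubriemannian

/-! ## Fundamental graded Lie algebras -/

section FGLA

variable {M : Type*} [LieRing M] [LieAlgebra ℝ M]

/-- A real graded Lie algebra `𝔪 = ⨁ 𝔪 p` is a *fundamental graded Lie algebra* if it is finite
dimensional, concentrated in negative degrees, and generated by the nonzero subspace `𝔪 (-1)`. -/
structure IsFGLA (𝔪 : ℤ → Submodule ℝ M) [GradedLieAlgebra 𝔪] : Prop where
  finiteDimensional : FiniteDimensional ℝ M
  eq_bot_of_nonneg : ∀ p : ℤ, 0 ≤ p → 𝔪 p = ⊥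
  ne_bot : 𝔪 (-1) ≠ ⊥
  generated : LieSubalgebra.lieSpan ℝ M (𝔪 (-1) : Set M) = ⊤

/-- `(𝔪, [g])` is a *conformal pseudo-subriemannian FGLA*: `𝔪` is an FGLA with `𝔪 (-2) ≠ 0`, and
`g` is a nondegenerate symmetric bilinear form on `𝔪 (-1)`. The conformal class `[g]` is given by
any of its representatives `g`; every notion below is unchanged if `g` is replaced by `η g`,
`η > 0`. -/
structure IsConformalFGLA (𝔪 : ℤ → Submodule ℝ M) [GradedLieAlgebra 𝔪]
    (g : LinearMap.BilinForm ℝ (𝔪 (-1))) : Prop extends IsFGLA 𝔪 where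
  ne_bot_two : 𝔪 (-2) ≠ ⊥
  symm : g.IsSymm
  nondegenerate : g.Nondegenerate

/-- The Lie algebra of all derivations `D` of `𝔪` with `D (𝔪 p) ⊆ 𝔪 p` for all `p < 0`. -/
def gradedDerivations (𝔪 : ℤ → Submodule ℝ M) : LieSubalgebra ℝ (LieDerivation ℝ M M) where
  carrier := {D | ∀ p : ℤ, p < 0 → ∀ x ∈ 𝔪 p, D x ∈ 𝔪 p}
  add_mem' hD hD' p hp x hx := (𝔪 p).add_mem (hD p hp x hx) (hD' p hp x hx)
  zero_mem' p _ _ _ := (𝔪 p).zero_mem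
  smul_mem' c _ hD p hp x hx := (𝔪 p).smul_mem c (hD p hp x hx)
  lie_mem' {D D'} hD hD' p hp x hx := by
    rw [LieDerivation.commutator_apply]
    exact (𝔪 p).sub_mem (hD p hp _ (hD' p hp x hx)) (hD' p hp _ (hD p hp x hx))

/-- The representation `ρ₋₁` of degree preserving derivations on `𝔪 (-1)`, `D • x = D x`. -/
instance gradedDerivations.instLieRingModule (𝔪 : ℤ → Submodule ℝ M) :
    LieRingModule (gradedDerivations 𝔪) (𝔪 (-1)) where
  bracket D x := ⟨D.1 x.1, D.2 (-1) (by norm_num) x.1 x.2⟩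
  add_lie _ _ _ := rfl
  lie_add D x y := Subtype.ext (map_add D.1 x.1 y.1)
  leibniz_lie D D' x := Subtype.ext (by
    change D.1 (D'.1 x.1) = (⁅D.1, D'.1⁆ : LieDerivation ℝ M M) x.1 + D'.1 (D.1 x.1)
    rw [LieDerivation.commutator_apply, sub_add_cancel])

instance gradedDerivations.instLieModule (𝔪 : ℤ → Submodule ℝ M) :
    LieModule ℝ (gradedDerivations 𝔪) (𝔪 (-1)) where
  smul_lie _ _ _ := rfl
  lie_smul t D x := Subtype.ext (map_smul D.1 t x.1)

theorem gradedDerivations.coe_lie (𝔪 : ℤ → Submodule ℝ M) (D : gradedDerivations 𝔪)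
    (x : 𝔪 (-1)) : ((⁅D, x⁆ : 𝔪 (-1)) : M) = D.1 x.1 := rfl

/-- The Lie algebra `𝔤₀` of all degree preserving derivations `D` of `𝔪` whose restriction to
`𝔪 (-1)` lies in `𝔠𝔬(𝔪 (-1), g)`, i.e. `g (D x) y + g x (D y) = η g x y` for some real `η`. -/
def conformalDerivations (𝔪 : ℤ → Submodule ℝ M) (g : LinearMap.BilinForm ℝ (𝔪 (-1))) :
    LieSubalgebra ℝ (gradedDerivations 𝔪) where
  carrier := {D | ∃ η : ℝ, ∀ x y : 𝔪 (-1), g ⁅D, x⁆ y + g x ⁅D, y⁆ = η * g x y}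
  add_mem' := by
    rintro D D' ⟨η, h⟩ ⟨η', h'⟩
    refine ⟨η + η', fun x y => ?_⟩
    simp only [add_lie, map_add, LinearMap.add_apply]
    linear_combination h x y + h' x y
  zero_mem' := ⟨0, fun x y => by simp⟩
  smul_mem' := by
    rintro c D ⟨η, h⟩
    refine ⟨c * η, fun x y => ?_⟩
    simp only [smul_lie, map_smul, LinearMap.smul_apply, smul_eq_mul]
    linear_combination c * h x y
  lie_mem' := by
    rintro D D' ⟨η, h⟩ ⟨η', h'⟩
    refine ⟨0, fun x y => ?_⟩
    simp only [lie_lie, map_sub, LinearMap.sub_apply]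
    linear_combination h ⁅D', x⁆ y - h' ⁅D, x⁆ y + h x ⁅D', y⁆ - h' x ⁅D, y⁆
      - η' * h x y + η * h' x y

/-- The subalgebra `𝔤̂₀ = ρ₋₁⁻¹(𝔰𝔬(𝔪 (-1), g))` of `𝔤₀`. -/
def isometricDerivations (𝔪 : ℤ → Submodule ℝ M) (g : LinearMap.BilinForm ℝ (𝔪 (-1))) :
    LieSubalgebra ℝ (conformalDerivations 𝔪 g) where
  carrier := {D | ∀ x y : 𝔪 (-1), g ⁅D, x⁆ y + g x ⁅D, y⁆ = 0}
  add_mem' := by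
    intro D D' h h' x y
    simp only [add_lie, map_add, LinearMap.add_apply]
    linear_combination h x y + h' x y
  zero_mem' x y := by simp
  smul_mem' := by
    intro c D h x y
    simp only [smul_lie, map_smul, LinearMap.smul_apply, smul_eq_mul]
    linear_combination c * h x y
  lie_mem' := by
    intro D D' h h' x y
    simp only [lie_lie, map_sub, LinearMap.sub_apply]
    linear_combination h ⁅D', x⁆ y - h' ⁅D, x⁆ y + h x ⁅D', y⁆ - h' x ⁅D, y⁆

end FGLA

/-! ## The prolongation -/

/-- A graded Lie algebra `𝔤 = ⨁ 𝔤 p` is *transitive* if for `p ≥ 0` and `X ∈ 𝔤 p`,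
`[X, 𝔤 (-1)] = 0` implies `X = 0`. -/
def IsTransitive {L : Type*} [LieRing L] [LieAlgebra ℝ L] (𝔤 : ℤ → Submodule ℝ L) : Prop :=
  ∀ p : ℤ, 0 ≤ p → ∀ X ∈ 𝔤 p, (∀ Y ∈ 𝔤 (-1), ⁅X, Y⁆ = 0) → X = 0

/-- The graded Lie algebra `𝔤 = ⨁ 𝔤 p`, with the inclusion `ι : 𝔪 → 𝔤`, is the (Tanaka)
*prolongation* of `(𝔪, [g])`: its negative part is `𝔪`, its degree zero part is the Lie algebra
`conformalDerivations 𝔪 g` (acting on `𝔪` by the bracket), it is transitive, and it is the largest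
such algebra: for `k ≥ 1`, the space `𝔤 k` consists of *all* linear maps `φ : 𝔪 → 𝔤` of degree `k`
with `φ [x, y] = [φ x, y] + [x, φ y]`. This determines `𝔤` up to a unique isomorphism over `𝔪`. -/
structure IsProlongation {M L : Type*} [LieRing M] [LieAlgebra ℝ M] [LieRing L] [LieAlgebra ℝ L]
    (𝔪 : ℤ → Submodule ℝ M) (g : LinearMap.BilinForm ℝ (𝔪 (-1)))
    (𝔤 : ℤ → Submodule ℝ L) (ι : M →ₗ⁅ℝ⁆ L) : Prop where
  injective : Function.Injective ι
  map_neg : ∀ p : ℤ, p < 0 → (𝔪 p).map (ι : M →ₗ[ℝ] L) = 𝔤 p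
  /-- Every element of `𝔤 0` acts on `𝔪` as an element of `conformalDerivations 𝔪 g`. -/
  zero_acts : ∀ A ∈ 𝔤 0, ∃ D ∈ conformalDerivations 𝔪 g, ∀ x : M, ⁅A, ι x⁆ = ι (D.1 x)
  /-- Every element of `conformalDerivations 𝔪 g` comes from `𝔤 0`. -/
  zero_surj : ∀ D ∈ conformalDerivations 𝔪 g, ∃ A ∈ 𝔤 0, ∀ x : M, ⁅A, ι x⁆ = ι (D.1 x)
  transitive : IsTransitive 𝔤
  maximal : ∀ k : ℤ, 1 ≤ k → ∀ φ : M →ₗ[ℝ] L,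
    (∀ p : ℤ, p < 0 → ∀ x ∈ 𝔪 p, φ x ∈ 𝔤 (p + k)) →
    (∀ x y : M, φ ⁅x, y⁆ = ⁅φ x, ι y⁆ + ⁅ι x, φ y⁆) →
    ∃ A ∈ 𝔤 k, ∀ x : M, ⁅A, ι x⁆ = φ x

/-! ## Isotropic subspaces, contragredient modules, simple graded Lie algebras -/

/-- A subspace on which the bilinear form `B` vanishes identically. -/
def IsTotallyIsotropic {K V : Type*} [CommRing K] [AddCommGroup V] [Module K V]
    (B : LinearMap.BilinForm K V) (W : Submodule K V) : Prop :=
  ∀ x ∈ W, ∀ y ∈ W, B x y = 0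

/-- `V` is *contragredient* to `W` as an `𝔞`-module if `V` is isomorphic, as an `𝔞`-module, to the
dual module of `W`. -/
def IsContragredient (K 𝔞 V W : Type*) [CommRing K] [LieRing 𝔞] [LieAlgebra K 𝔞]
    [AddCommGroup V] [Module K V] [LieRingModule 𝔞 V]
    [AddCommGroup W] [Module K W] [LieRingModule 𝔞 W] [LieModule K 𝔞 W] : Prop :=
  Nonempty (V ≃ₗ⁅K, 𝔞⁆ (W →ₗ[K] K))

/-- The complexification `H(ℂ)` of a subalgebra `H`, as a subalgebra of the complexification. -/
noncomputable def complexification {G : Type*} [LieRing G] [LieAlgebra ℝ G] (H : LieSubalgebra ℝ G) :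
    LieSubalgebra ℂ (ℂ ⊗[ℝ] G) where
  __ := H.toSubmodule.baseChange ℂ
  lie_mem' := by
    intro x y hx hy
    simp only [Submodule.mem_carrier, SetLike.mem_coe] at hx hy ⊢
    rw [Submodule.baseChange_eq_span] at hx hy
    induction hx, hy using Submodule.span_induction₂ with
    | mem_mem x y hx hy =>
      obtain ⟨a, ha, rfl⟩ := hx
      obtain ⟨b, hb, rfl⟩ := hy
      simp only [TensorProduct.mk_apply, LieAlgebra.ExtendScalars.bracket_tmul]
      exact Submodule.tmul_mem_baseChange_of_mem _ (H.lie_mem ha hb)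
    | zero_left y _ => simp
    | zero_right x _ => simp
    | add_left x y z _ _ _ h h' => rw [add_lie]; exact Submodule.add_mem _ h h'
    | add_right x y z _ _ _ h h' => rw [lie_add]; exact Submodule.add_mem _ h h'
    | smul_left r x y _ _ h => rw [smul_lie]; exact Submodule.smul_mem _ r h
    | smul_right r x y _ _ h => rw [lie_smul]; exact Submodule.smul_mem _ r h

/-- `𝔤 = ⨁ 𝔤 p` is a *simple graded Lie algebra* (SGLA) over `K`. -/
def IsSGLA (K : Type*) {L : Type*} [Field K] [LieRing L] [LieAlgebra K L]
    (𝔤 : ℤ → Submodule K L) : Prop :=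
  Nonempty (GradedLieAlgebra 𝔤) ∧ LieAlgebra.IsSimple K L

/-- A real SGLA is of *class (B)* if it is a real form of a complex simple Lie algebra such that
`𝔤(ℂ) = ⨁ 𝔤 p (ℂ)` is a complex SGLA. -/
def IsSGLAOfClassB {L : Type*} [LieRing L] [LieAlgebra ℝ L] (𝔤 : ℤ → Submodule ℝ L) : Prop :=
  IsSGLA ℝ 𝔤 ∧ IsSGLA ℂ (fun p => (𝔤 p).baseChange ℂ : ℤ → Submodule ℂ (ℂ ⊗[ℝ] L))

end PseudoSubriemannian

open PseudoSubriemannian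

/-! The derivation acting on `𝔪 p` as multiplication by `p` is conformal, so it comes from some `E`
in `𝔤 0`, and by transitivity `ad E` is multiplication by `p` on every `𝔤 p`. Since `𝔤` is
semisimple, its Killing form `κ` is nondegenerate, and `E` forces it to pair `𝔤 p` perfectly with `𝔤
(-p)`.

The key is that a proper `𝔤 0`-submodule `A` of `𝔤 (-1)` is killed by a central `z` of `𝔤 0` with
`κ(z, E) ≠ 0` (`exists_central`). Let `U` be the annihilator of `A` in `𝔤 1`. The `ad (𝔤 1)`-closure
of `U` lies in positive degrees and is stable under `A`, `𝔤 0` and `𝔤 1`. There `E` has nonzero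
trace, while `[A, 𝔤 1]` and `[𝔤 0, 𝔤 0]` have trace zero; `z` is the Killing dual of a functional
separating `E` from these brackets. Moreover `z` does not square to zero on `𝔤 (-1)`, since
otherwise `ad z` would be nilpotent and `κ(z, E) = 0`.

For a maximal submodule `W` this gives `V = W ⊕ z V`. Over an algebraically closed field, an
eigenvector of `z` in `z V` shows that `W` must be isotropic. Hence all proper submodules are
isotropic, and nondegeneracy makes the nonzero ones both maximal and minimal; the form then pairs
`W` with `z V`. Over `ℝ` the same `z` gives a real complement, and the other properties descend from
`ℂ`.

If `𝔤(ℂ)` split into two ideals, `𝔤 0` would act by scalars on the degree `-1` part of each, so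
these parts would be lines. Then `𝔤 (-1)` would be abelian, contradicting `𝔤 (-2) ≠ 0`. Simplicity
over `ℂ` implies simplicity over `ℝ`. -/

/-! ### Grading elements and the Killing form -/

section GradingElement

variable {K G : Type*} [Field K] [LieRing G] [LieAlgebra K G]

/-- `E` is a grading element: `[E, x] = p x` for all `x` of degree `p`. -/
structure IsGradingElement (𝒢 : ℤ → Submodule K G) (E : G) : Prop where
  mem : E ∈ 𝒢 0
  lie_eq : ∀ p : ℤ, ∀ x ∈ 𝒢 p, ⁅E, x⁆ = (p : K) • x

/-- Invariance, `κ([x, E], y) = κ(x, [E, y])`, gives `-p κ(x, y) = q κ(x, y)`. -/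
theorem IsGradingElement.killingForm_eq_zero [CharZero K] {𝒢 : ℤ → Submodule K G} {E : G}
    (hE : IsGradingElement 𝒢 E) {p q : ℤ} (h : p + q ≠ 0) {x y : G} (hx : x ∈ 𝒢 p)
    (hy : y ∈ 𝒢 q) : killingForm K G x y = 0 := by
  have h1 := LieModule.traceForm_apply_lie_apply K G G x E y
  have h2 : ⁅x, E⁆ = -((p : K) • x) := by rw [← lie_skew, hE.lie_eq p x hx]
  rw [h2, hE.lie_eq q y hy] at h1
  simp only [map_neg, map_smul, LinearMap.neg_apply, LinearMap.smul_apply, smul_eq_mul] at h1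
  have h3 : ((p + q : ℤ) : K) * killingForm K G x y = 0 := by
    push_cast
    change ((p : K) + q) * LieModule.traceForm K G G x y = 0
    linear_combination -h1
  exact (mul_eq_zero.mp h3).resolve_left (by exact_mod_cast h)

variable {𝒢 : ℤ → Submodule K G} [GradedLieAlgebra 𝒢]

theorem lie_mem_graded {p q r : ℤ} (h : p + q = r) {x y : G} (hx : x ∈ 𝒢 p) (hy : y ∈ 𝒢 q) :
    ⁅x, y⁆ ∈ 𝒢 r :=
  h ▸ SetLike.GradedBracket.bracket_mem hx hy

variable {E : G}

theorem IsGradingElement.decompose_lie (hE : IsGradingElement 𝒢 E) (x : G) (q : ℤ) :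
    ((DirectSum.decompose 𝒢 ⁅E, x⁆ q : 𝒢 q) : G) = (q : K) • (DirectSum.decompose 𝒢 x q : G) := by
  induction x using DirectSum.Decomposition.inductionOn 𝒢 with
  | zero => simp
  | @homogeneous i m =>
    rw [hE.lie_eq i m m.2, DirectSum.decompose_smul, DirectSum.decompose_coe,
      DirectSum.smul_apply, Submodule.coe_smul]
    by_cases h : i = q
    · subst h; simp
    · simp [DirectSum.of_eq_of_ne _ _ _ (Ne.symm h)]
  | add m m' h h' =>
    simp only [lie_add, DirectSum.decompose_add, DirectSum.add_apply, Submodule.coe_add, h, h',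
      smul_add]

theorem IsGradingElement.iSup_eigenspace (hE : IsGradingElement 𝒢 E) :
    ⨆ μ, (LieAlgebra.ad K G E).eigenspace μ = ⊤ := by
  classical
  rw [eq_top_iff]
  intro x _
  rw [← DirectSum.sum_support_decompose 𝒢 x]
  refine Submodule.sum_mem _ fun q _ => ?_
  refine Submodule.mem_iSup_of_mem (q : K) (Module.End.mem_eigenspace_iff.mpr ?_)
  exact hE.lie_eq q _ (Subtype.coe_prop _)

variable [CharZero K]

theorem IsGradingElement.mem_of_lie_eq (hE : IsGradingElement 𝒢 E) {p : ℤ} {x : G}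
    (h : ⁅E, x⁆ = (p : K) • x) : x ∈ 𝒢 p := by
  classical
  rw [← DirectSum.sum_support_decompose 𝒢 x]
  refine Submodule.sum_mem _ fun q _ => ?_
  have h1 := hE.decompose_lie x q
  rw [h, DirectSum.decompose_smul, DirectSum.smul_apply, Submodule.coe_smul, ← sub_eq_zero,
    ← sub_smul, smul_eq_zero, sub_eq_zero, Int.cast_inj] at h1
  rcases h1 with rfl | h1
  · exact Subtype.coe_prop _
  · rw [h1]; exact zero_mem _

theorem IsGradingElement.killingForm_decompose (hE : IsGradingElement 𝒢 E) {p : ℤ} (x : G) {y : G}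
    (hy : y ∈ 𝒢 (-p)) :
    killingForm K G (DirectSum.decompose 𝒢 x p : G) y = killingForm K G x y := by
  classical
  conv_rhs => rw [← DirectSum.sum_support_decompose 𝒢 x]
  rw [map_sum, LinearMap.sum_apply, Finset.sum_eq_single p]
  · intro q _ hq
    exact hE.killingForm_eq_zero (by omega) (Subtype.coe_prop _) hy
  · intro hp
    rw [DFinsupp.notMem_support_iff] at hp
    simp [hp]

variable [LieAlgebra.IsKilling K G]

/-- Pairing `x` with an arbitrary element sees only the component of degree `-p`, so nondegeneracy
of `κ` restricts to opposite degrees. -/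
theorem IsGradingElement.eq_zero_of_killingForm (hE : IsGradingElement 𝒢 E) {p : ℤ} {x : G}
    (hx : x ∈ 𝒢 p) (h : ∀ y ∈ 𝒢 (-p), killingForm K G x y = 0) : x = 0 := by
  refine (LieAlgebra.IsKilling.killingForm_nondegenerate K G).1 x fun y => ?_
  rw [LieModule.traceForm_comm]
  have := hE.killingForm_decompose (p := -p) y (y := x) (by simpa using hx)
  rw [← this, LieModule.traceForm_comm]
  exact h _ (Subtype.coe_prop _)

variable [FiniteDimensional K G]

/-- Functionals on the part of degree `-p` are represented by elements of degree `p`. -/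
theorem IsGradingElement.exists_killingForm_eq (hE : IsGradingElement 𝒢 E) (p : ℤ)
    (f : G →ₗ[K] K) :
    ∃ x ∈ 𝒢 p, ∀ y ∈ 𝒢 (-p), killingForm K G x y = f y := by
  obtain ⟨x, hx⟩ := (LinearMap.BilinForm.toDual (killingForm K G)
    (LieAlgebra.IsKilling.killingForm_nondegenerate K G)).surjective f
  refine ⟨DirectSum.decompose 𝒢 x p, Subtype.coe_prop _, fun y hy => ?_⟩
  rw [hE.killingForm_decompose x hy, ← hx, LinearMap.BilinForm.toDual_def]

end GradingElement

/-! ### Positivity of traces -/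

section Trace

/-- A diagonalizable endomorphism all of whose eigenvalues are positive integers has nonzero
trace. -/
theorem trace_ne_zero_of_eigenvalues_pos {K M : Type*} [Field K] [CharZero K] [AddCommGroup M]
    [Module K M] [FiniteDimensional K M] [Nontrivial M] (f : Module.End K M)
    (htop : ⨆ μ, f.eigenspace μ = ⊤)
    (hpos : ∀ μ, f.eigenspace μ ≠ ⊥ → ∃ n : ℕ, 0 < n ∧ μ = n) : LinearMap.trace K M f ≠ 0 := by
  classical
  have hind := f.eigenspaces_iSupIndep
  have hint := DirectSum.isInternal_submodule_of_iSupIndep_of_iSup_eq_top hind htop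
  have hfin : {μ | f.eigenspace μ ≠ ⊥}.Finite := WellFoundedGT.finite_ne_bot_of_iSupIndep hind
  have hmaps : ∀ μ, Set.MapsTo f (f.eigenspace μ) (f.eigenspace μ) := fun μ x hx => by
    rw [SetLike.mem_coe, Module.End.mem_eigenspace_iff] at hx ⊢
    rw [hx, map_smul, hx]
  choose! n hn0 hn using hpos
  -- Each eigenspace contributes eigenvalue times dimension. Writing it as a cast natural number
  -- allows positivity to be argued in `ℕ`, as `K` carries no order.
  have key : ∀ μ ∈ hfin.toFinset, LinearMap.trace K _ (f.restrict (hmaps μ)) =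
      ((n μ * Module.finrank K (f.eigenspace μ) : ℕ) : K) := fun μ hμ => by
    have : f.restrict (hmaps μ) = μ • LinearMap.id := by
      exact LinearMap.ext fun x => Subtype.ext (Module.End.mem_eigenspace_iff.mp x.2)
    rw [this, map_smul, LinearMap.trace_id, smul_eq_mul, Nat.cast_mul,
      ← hn μ (by simpa using hμ)]
  rw [LinearMap.trace_eq_sum_trace_restrict' hint hfin hmaps, Finset.sum_congr rfl key,
    ← Nat.cast_sum, Nat.cast_ne_zero, ← Nat.pos_iff_ne_zero]
  obtain ⟨μ, hμ⟩ : ∃ μ, f.eigenspace μ ≠ ⊥ := by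
    by_contra! h
    exact bot_ne_top (by rw [← htop]; simp [h] : (⊥ : Submodule K M) = ⊤)
  refine Finset.sum_pos' (fun _ _ => Nat.zero_le _) ⟨μ, by simpa using hμ, ?_⟩
  have : Nontrivial (f.eigenspace μ) := Submodule.nontrivial_iff_ne_bot.mpr hμ
  exact Nat.mul_pos (hn0 μ hμ) Module.finrank_pos

end Trace

/-! ### Central elements annihilating a submodule of degree `-1` -/

section KeyLemma

variable {K G : Type*} [Field K] [CharZero K] [LieRing G] [LieAlgebra K G]
  {𝒢 : ℤ → Submodule K G} [GradedLieAlgebra 𝒢] {E : G}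

/-- The grading element is not a linear combination of commutators of elements preserving a nonzero
subspace of elements of positive degree: its trace on that subspace is positive. -/
theorem IsGradingElement.notMem_span_lie [FiniteDimensional K G] (hE : IsGradingElement 𝒢 E)
    (M : Submodule K G) (hM : M ≠ ⊥)
    (hpos : ∀ x ∈ M, ∀ p : ℤ, p ≤ 0 → DirectSum.decompose 𝒢 x p = 0)
    (S : Set G)
    (hS : ∀ s ∈ S, ∃ a b : G, s = ⁅a, b⁆ ∧ (∀ x ∈ M, ⁅a, x⁆ ∈ M) ∧ ∀ x ∈ M, ⁅b, x⁆ ∈ M) :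
    E ∉ Submodule.span K S := by
  intro hmem
  have hstab : ∀ s ∈ Submodule.span K S, ∃ h : ∀ x ∈ M, LieAlgebra.ad K G s x ∈ M,
      LinearMap.trace K M ((LieAlgebra.ad K G s).restrict h) = 0 := by
    intro s hs
    induction hs using Submodule.span_induction with
    | mem s hs =>
      obtain ⟨a, b, rfl, ha, hb⟩ := hS s hs
      refine ⟨fun x hx => ?_, ?_⟩
      · rw [LieAlgebra.ad_apply, lie_lie]
        exact M.sub_mem (ha _ (hb x hx)) (hb _ (ha x hx))
      · convert LinearMap.trace_lie (R := K) (M := M) ((LieAlgebra.ad K G a).restrict ha)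
          ((LieAlgebra.ad K G b).restrict hb) using 2
        exact LinearMap.ext fun x => Subtype.ext (lie_lie a b (x : G))
    | zero =>
      refine ⟨by simp, ?_⟩
      rw [← map_zero (LinearMap.trace K M)]
      congr 1
      exact LinearMap.ext fun x => Subtype.ext (zero_lie (x : G))
    | add s t _ _ hs ht =>
      obtain ⟨hs, hs'⟩ := hs
      obtain ⟨ht, ht'⟩ := ht
      refine ⟨fun x hx => by simpa using M.add_mem (hs x hx) (ht x hx), ?_⟩
      have h := map_add (LinearMap.trace K M) ((LieAlgebra.ad K G s).restrict hs)
        ((LieAlgebra.ad K G t).restrict ht)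
      rw [hs', ht', add_zero] at h
      rw [← h]
      congr 1
      exact LinearMap.ext fun x => Subtype.ext (add_lie s t (x : G))
    | smul c s _ hs =>
      obtain ⟨hs, hs'⟩ := hs
      refine ⟨fun x hx => by simpa using M.smul_mem c (hs x hx), ?_⟩
      have h := map_smul (LinearMap.trace K M) c ((LieAlgebra.ad K G s).restrict hs)
      rw [hs', smul_zero] at h
      rw [← h]
      congr 1
      exact LinearMap.ext fun x => Subtype.ext (smul_lie c s (x : G))
  obtain ⟨h, htr⟩ := hstab E hmem
  have : Nontrivial M := Submodule.nontrivial_iff_ne_bot.mpr hM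
  refine trace_ne_zero_of_eigenvalues_pos _
    (Module.End.genEigenspace_restrict_eq_top h hE.iSup_eigenspace) (fun μ hμ => ?_) htr
  -- Comparing a nonzero component of an eigenvector, of degree `p`, on both sides identifies the
  -- eigenvalue as `p`, and `hpos` makes `p` positive.
  obtain ⟨x, hx, hx0⟩ := Submodule.exists_mem_ne_zero_of_ne_bot hμ
  rw [Module.End.mem_eigenspace_iff, Subtype.ext_iff] at hx
  replace hx : ⁅E, (x : G)⁆ = μ • (x : G) := hx
  obtain ⟨p, hp⟩ : ∃ p, (DirectSum.decompose 𝒢 (x : G) p : G) ≠ 0 := by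
    by_contra! h0
    apply hx0
    ext
    classical
    rw [← DirectSum.sum_support_decompose 𝒢 (x : G)]
    simp [h0]
  have hp1 : 0 < p := by
    by_contra! hp1
    exact hp (by rw [hpos x x.2 p hp1]; rfl)
  have h1 := hE.decompose_lie (x : G) p
  rw [hx, DirectSum.decompose_smul, DirectSum.smul_apply, Submodule.coe_smul, ← sub_eq_zero,
    ← sub_smul, smul_eq_zero, or_iff_left hp, sub_eq_zero] at h1
  lift p to ℕ using hp1.le
  exact ⟨p, by exact_mod_cast hp1, by simpa using h1⟩

/-- A proper `𝒢 0`-stable subspace of `𝒢 (-1)` is annihilated by a central element of `𝒢 0` which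
is not Killing orthogonal to the grading element. -/
theorem IsGradingElement.exists_central [FiniteDimensional K G] [LieAlgebra.IsKilling K G]
    (hE : IsGradingElement 𝒢 E) (A : Submodule K G) (hA : A < 𝒢 (-1))
    (hA0 : ∀ x ∈ 𝒢 0, ∀ a ∈ A, ⁅x, a⁆ ∈ A) :
    ∃ z ∈ 𝒢 0, (∀ a ∈ A, ⁅z, a⁆ = 0) ∧ (∀ x ∈ 𝒢 0, ⁅z, x⁆ = 0) ∧ killingForm K G z E ≠ 0 := by
  let κ := killingForm K G
  obtain ⟨v, hv, hvA⟩ := SetLike.exists_of_lt hA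
  -- The annihilator of `A` in `𝒢 1`; it is nonzero because `A` is proper, and `[A, U] = 0` because
  -- `κ(y, [a, u]) = κ([y, a], u)` for `y` in `𝒢 0`.
  let U : Submodule K G :=
    { carrier := {u | u ∈ 𝒢 1 ∧ ∀ a ∈ A, κ a u = 0}
      add_mem' := fun hx hy => ⟨add_mem hx.1 hy.1, fun a ha => by
        rw [map_add, hx.2 a ha, hy.2 a ha, add_zero]⟩
      zero_mem' := ⟨zero_mem _, fun a _ => map_zero _⟩
      smul_mem' := fun c x hx => ⟨Submodule.smul_mem _ c hx.1, fun a ha => by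
        rw [map_smul, hx.2 a ha, smul_zero]⟩ }
  have hU : U ≠ ⊥ := by
    obtain ⟨f, hf, hAf⟩ := Submodule.exists_le_ker_of_notMem hvA
    obtain ⟨u, hu, huf⟩ := hE.exists_killingForm_eq 1 f
    refine Submodule.ne_bot_iff _ |>.mpr ⟨u, ⟨hu, fun a ha => ?_⟩, ?_⟩
    · change killingForm K G a u = 0
      rw [LieModule.traceForm_comm]
      exact (huf a (hA.le ha)).trans (hAf ha)
    · rintro rfl
      exact hf (by rw [← huf v hv]; simp)
  have hU0 : ∀ x ∈ 𝒢 0, ∀ u ∈ U, ⁅x, u⁆ ∈ U := fun x hx u hu =>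
    ⟨lie_mem_graded (by norm_num) hx hu.1, fun a ha => by
      have h1 := LieModule.traceForm_apply_lie_apply K G G a x u
      have h2 : κ ⁅a, x⁆ u = 0 := by
        rw [← lie_skew, map_neg, LinearMap.neg_apply, hu.2 _ (hA0 x hx a ha), neg_zero]
      exact h1.symm.trans h2⟩
  have hUA : ∀ a ∈ A, ∀ u ∈ U, ⁅a, u⁆ = 0 := fun a ha u hu => by
    refine hE.eq_zero_of_killingForm (p := 0)
      (lie_mem_graded (by norm_num) (hA.le ha) hu.1) fun y hy => ?_
    rw [neg_zero] at hy
    have h1 := LieModule.traceForm_apply_lie_apply K G G y a u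
    rw [LieModule.traceForm_comm]
    exact h1.symm.trans (hu.2 _ (hA0 y hy a ha))
  -- The closure of `U` under `ad (𝒢 1)`.
  let M : Submodule K G := sInf {N | U ≤ N ∧ ∀ u ∈ 𝒢 1, ∀ x ∈ N, ⁅u, x⁆ ∈ N}
  have hMU : U ≤ M := le_sInf fun N hN => hN.1
  have hM1 : ∀ u ∈ 𝒢 1, ∀ x ∈ M, ⁅u, x⁆ ∈ M := fun u hu x hx => by
    rw [Submodule.mem_sInf] at hx ⊢
    exact fun N hN => hN.2 u hu x (hx N hN)
  -- Induction principle for `M`: by the Leibniz rule, the elements of `M` sent into `M` by all of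
  -- `S` form a subspace stable under `ad (𝒢 1)`. It is applied to `𝒢 0` first, then to `A`, using
  -- `[A, 𝒢 1] ⊆ 𝒢 0`.
  have hMind : ∀ S : Set G, (∀ u ∈ U, ∀ s ∈ S, ⁅s, u⁆ ∈ M) →
      (∀ s ∈ S, ∀ u ∈ 𝒢 1, ∀ x ∈ M, ⁅⁅s, u⁆, x⁆ ∈ M) → ∀ x ∈ M, ∀ s ∈ S, ⁅s, x⁆ ∈ M := by
    intro S h0 h1
    let N : Submodule K G :=
      { carrier := {x | x ∈ M ∧ ∀ s ∈ S, ⁅s, x⁆ ∈ M}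
        add_mem' := fun hx hy => ⟨add_mem hx.1 hy.1, fun s hs => by
          rw [lie_add]; exact add_mem (hx.2 s hs) (hy.2 s hs)⟩
        zero_mem' := ⟨zero_mem _, fun s _ => by rw [lie_zero]; exact zero_mem _⟩
        smul_mem' := fun c x hx => ⟨Submodule.smul_mem _ c hx.1, fun s hs => by
          rw [lie_smul]; exact Submodule.smul_mem _ c (hx.2 s hs)⟩ }
    have : M ≤ N := sInf_le ⟨fun u hu => ⟨hMU hu, h0 u hu⟩, fun u hu x hx =>
      ⟨hM1 u hu x hx.1, fun s hs => by
        rw [leibniz_lie]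
        exact add_mem (h1 s hs u hu x hx.1) (hM1 u hu _ (hx.2 s hs))⟩⟩
    exact fun x hx => (this hx).2
  have hM0 : ∀ x ∈ M, ∀ s ∈ 𝒢 0, ⁅s, x⁆ ∈ M :=
    hMind (𝒢 0) (fun u hu s hs => hMU (hU0 s hs u hu))
      (fun s hs u hu x hx => hM1 _ (lie_mem_graded (by norm_num) hs hu) x hx)
  have hMA : ∀ x ∈ M, ∀ s ∈ A, ⁅s, x⁆ ∈ M :=
    hMind A (fun u hu s hs => by rw [hUA s hs u hu]; exact zero_mem _)
      (fun s hs u hu x hx => hM0 x hx _ (lie_mem_graded (by norm_num) (hA.le hs) hu))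
  have hpos : ∀ x ∈ M, ∀ p : ℤ, p ≤ 0 → DirectSum.decompose 𝒢 x p = 0 := by
    let N : Submodule K G := ⨆ p : Set.Ioi (0 : ℤ), 𝒢 p
    have hN : M ≤ N := by
      refine sInf_le ⟨fun u hu => Submodule.mem_iSup_of_mem ⟨1, by simp⟩ hu.1, fun u hu x hx => ?_⟩
      induction hx using Submodule.iSup_induction' with
      | mem p x hx =>
        exact Submodule.mem_iSup_of_mem
          (⟨1 + p, add_pos (one_pos : (0 : ℤ) < 1) p.2⟩ : Set.Ioi (0 : ℤ))
          (lie_mem_graded rfl hu hx)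
      | zero => simp
      | add x y _ _ hx hy => rw [lie_add]; exact add_mem hx hy
    intro x hx p hp
    replace hx := hN hx
    induction hx using Submodule.iSup_induction' with
    | mem q x hx =>
      have hq : (0 : ℤ) < q := q.2
      ext
      rw [DirectSum.decompose_of_mem_ne 𝒢 hx (by omega)]
      rfl
    | zero => simp
    | add x y _ _ hx hy => rw [DirectSum.decompose_add, DirectSum.add_apply, hx, hy, add_zero]
  let S : Set G := {s | (∃ a ∈ A, ∃ u ∈ 𝒢 1, s = ⁅a, u⁆) ∨ ∃ x ∈ 𝒢 0, ∃ y ∈ 𝒢 0, s = ⁅x, y⁆}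
  have hES : E ∉ Submodule.span K S := by
    refine hE.notMem_span_lie M (fun h => hU (le_bot_iff.mp (h ▸ hMU))) hpos
      S ?_
    rintro s (⟨a, ha, u, hu, rfl⟩ | ⟨x, hx, y, hy, rfl⟩)
    · exact ⟨a, u, rfl, fun m hm => hMA m hm a ha, hM1 u hu⟩
    · exact ⟨x, y, rfl, fun m hm => hM0 m hm x hx, fun m hm => hM0 m hm y hy⟩
  -- The Killing dual `z` of a functional vanishing on `S` but not at `E`. By invariance, vanishing
  -- on `[A, 𝒢 1]` means `[z, A] = 0`, and vanishing on `[𝒢 0, 𝒢 0]` means that `z` is central in `𝒢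
  -- 0`.
  obtain ⟨f, hf, hSf⟩ := Submodule.exists_le_ker_of_notMem hES
  obtain ⟨z, hz, hzf⟩ := hE.exists_killingForm_eq 0 f
  rw [neg_zero] at hzf
  have hfS : ∀ s ∈ S, f s = 0 := fun s hs => hSf (Submodule.subset_span hs)
  refine ⟨z, hz, fun a ha => ?_, fun x hx => ?_, by rwa [hzf E hE.mem]⟩
  · refine hE.eq_zero_of_killingForm (p := -1)
      (lie_mem_graded (by norm_num) hz (hA.le ha)) fun u hu => ?_
    rw [neg_neg] at hu
    refine (LieModule.traceForm_apply_lie_apply K G G z a u).trans ?_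
    exact (hzf _ (lie_mem_graded (by norm_num) (hA.le ha) hu)).trans
      (hfS _ (Or.inl ⟨a, ha, u, hu, rfl⟩))
  · refine hE.eq_zero_of_killingForm (p := 0)
      (lie_mem_graded (by norm_num) hz hx) fun y hy => ?_
    rw [neg_zero] at hy
    refine (LieModule.traceForm_apply_lie_apply K G G z x y).trans ?_
    exact (hzf _ (lie_mem_graded (by norm_num) hx hy)).trans
      (hfS _ (Or.inr ⟨x, hx, y, hy, rfl⟩))

/-- The subalgebra `⨁ p < 0, 𝒢 p` is generated by `𝒢 (-1)`. -/
def IsNegativelyGenerated (𝒢 : ℤ → Submodule K G) : Prop :=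
  ∀ S : LieSubalgebra K G, 𝒢 (-1) ≤ S.toSubmodule → ∀ p : ℤ, p < 0 → 𝒢 p ≤ S.toSubmodule

/-- Otherwise `ad z` is nilpotent: on negative degrees because its Engel subalgebra contains the
generators, on `𝒢 0` because it vanishes there, and on positive degrees because it is skew for `κ`.
It commutes with `ad E`, so `κ(z, E)` would be the trace of a nilpotent map. -/
theorem IsGradingElement.exists_lie_lie_ne_zero [FiniteDimensional K G] [LieAlgebra.IsKilling K G]
    (hE : IsGradingElement 𝒢 E) (hgen : IsNegativelyGenerated 𝒢) {z : G} (hz : z ∈ 𝒢 0)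
    (hz0 : ∀ x ∈ 𝒢 0, ⁅z, x⁆ = 0) (hzE : killingForm K G z E ≠ 0) :
    ∃ v ∈ 𝒢 (-1), ⁅z, ⁅z, v⁆⁆ ≠ 0 := by
  by_contra! h
  have h1 : ∀ p < 0, 𝒢 p ≤ (LieSubalgebra.engel K z).toSubmodule :=
    hgen _ fun v hv => (LieSubalgebra.mem_engel_iff K z v).mpr ⟨2, by simpa [pow_two] using h v hv⟩
  let f : Module.End K G := LieAlgebra.ad K G z
  have hle : ∀ p ≤ 0, ∀ x ∈ 𝒢 p, ∃ n : ℕ, (f ^ n) x = 0 := fun p hp x hx => by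
    rcases hp.lt_or_eq with hp | rfl
    · exact (LieSubalgebra.mem_engel_iff K z x).mp (h1 p hp hx)
    · exact ⟨1, by rw [pow_one]; exact hz0 x hx⟩
  -- A single exponent valid in all degrees.
  let N := Module.finrank K G
  have hleN : ∀ p ≤ 0, ∀ x ∈ 𝒢 p, (f ^ N) x = 0 := fun p hp x hx => by
    obtain ⟨n, hn⟩ := hle p hp x hx
    have : x ∈ f.maxGenEigenspace 0 := by
      rw [Module.End.mem_maxGenEigenspace]; exact ⟨n, by rwa [zero_smul, sub_zero]⟩
    rw [Module.End.maxGenEigenspace_eq_genEigenspace_finrank,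
      Module.End.mem_genEigenspace_nat, zero_smul, sub_zero] at this
    exact this
  have hadj : ∀ (n : ℕ) (x y : G),
      killingForm K G ((f ^ n) x) y = (-1) ^ n * killingForm K G x ((f ^ n) y) := by
    intro n
    induction n with
    | zero => simp
    | succ n ih =>
      intro x y
      have h2 := LieModule.traceForm_apply_lie_apply K G G ((f ^ n) x) z y
      rw [pow_succ', Module.End.mul_apply, ← pow_succ', pow_succ f, Module.End.mul_apply, pow_succ]
      change killingForm K G ⁅z, (f ^ n) x⁆ y = _
      rw [← lie_skew, map_neg, LinearMap.neg_apply]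
      refine (congrArg Neg.neg (h2.trans (ih x ⁅z, y⁆))).trans ?_
      change _ = (-1) ^ n * -1 * killingForm K G x ((f ^ n) ⁅z, y⁆)
      ring
  have hdeg : ∀ (n : ℕ) (p : ℤ), ∀ x ∈ 𝒢 p, (f ^ n) x ∈ 𝒢 p := by
    intro n
    induction n with
    | zero => simp
    | succ n ih =>
      intro p x hx
      rw [pow_succ', Module.End.mul_apply]
      exact lie_mem_graded (zero_add p) hz (ih p x hx)
  have hall : ∀ p, ∀ x ∈ 𝒢 p, (f ^ N) x = 0 := fun p x hx => by
    rcases le_or_gt p 0 with hp | hp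
    · exact hleN p hp x hx
    · refine hE.eq_zero_of_killingForm (hdeg N p x hx) fun y hy => ?_
      rw [hadj, hleN (-p) (by omega) y hy, map_zero, mul_zero]
  have hnil : IsNilpotent f := by
    refine ⟨N, LinearMap.ext fun x => ?_⟩
    classical
    rw [← DirectSum.sum_support_decompose 𝒢 x, map_sum]
    exact Finset.sum_eq_zero fun p _ => hall p _ (Subtype.coe_prop _)
  have hcomm : Commute f (LieAlgebra.ad K G E) := by
    refine LinearMap.ext fun x => ?_
    change ⁅z, ⁅E, x⁆⁆ = ⁅E, ⁅z, x⁆⁆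
    rw [leibniz_lie, hz0 E hE.mem, zero_lie, zero_add]
  apply hzE
  rw [killingForm_apply_apply]
  exact (LinearMap.isNilpotent_trace_of_isNilpotent (hcomm.isNilpotent_mul_right hnil)).eq_zero

end KeyLemma

/-! ### Modules with central annihilators and an invariant conformal class -/

section Representation

variable (K 𝔞 V : Type*) [Field K] [LieRing 𝔞] [LieAlgebra K 𝔞] [AddCommGroup V] [Module K V]
  [LieRingModule 𝔞 V] [LieModule K 𝔞 V]

/-- Every proper submodule of `V` is annihilated by an element of `𝔞` which acts on `V` by a
non-nilpotent `𝔞`-endomorphism. -/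
def HasCentralAnnihilators : Prop :=
  ∀ W : LieSubmodule K 𝔞 V, W ≠ ⊤ → ∃ z : 𝔞, (∀ w ∈ W, ⁅z, w⁆ = 0) ∧
    (∀ (a : 𝔞) (v : V), ⁅a, ⁅z, v⁆⁆ = ⁅z, ⁅a, v⁆⁆) ∧ ∃ v : V, ⁅z, ⁅z, v⁆⁆ ≠ 0

variable {K V}

/-- The Lie algebra `𝔞` acts on `V` by infinitesimal similarities of the bilinear form `b`. -/
def ActsConformally (b : LinearMap.BilinForm K V) : Prop :=
  ∀ a : 𝔞, ∃ η : K, ∀ x y : V, b ⁅a, x⁆ y + b x ⁅a, y⁆ = η * b x y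

variable {𝔞}

/-- The endomorphism of `V` defined by an element of `𝔞` commuting with the action. -/
def centralHom (z : 𝔞) (hz : ∀ (a : 𝔞) (v : V), ⁅a, ⁅z, v⁆⁆ = ⁅z, ⁅a, v⁆⁆) : V →ₗ⁅K, 𝔞⁆ V where
  __ := LieModule.toEnd K 𝔞 V z
  map_lie' {a v} := (hz a v).symm

@[simp] theorem centralHom_apply (z : 𝔞) (hz : ∀ (a : 𝔞) (v : V), ⁅a, ⁅z, v⁆⁆ = ⁅z, ⁅a, v⁆⁆)
    (v : V) : centralHom (K := K) z hz v = ⁅z, v⁆ := rfl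

/-- The kernels of `z` and `z²` are proper submodules containing the maximal `W`, so both equal `W`;
hence `W` meets the image of `z` trivially, and maximality makes their sum everything. -/
theorem HasCentralAnnihilators.exists_isCompl (hZ : HasCentralAnnihilators K 𝔞 V)
    {W : LieSubmodule K 𝔞 V} (hW : IsCoatom W) :
    ∃ (z : 𝔞) (hz : ∀ (a : 𝔞) (v : V), ⁅a, ⁅z, v⁆⁆ = ⁅z, ⁅a, v⁆⁆),
      (centralHom (K := K) z hz).ker = W ∧ IsCompl W (centralHom (K := K) z hz).range := by
  obtain ⟨z, hzW, hz, v, hv⟩ := hZ W hW.1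
  refine ⟨z, hz, ?_⟩
  set f := centralHom (K := K) z hz
  have h1 : f.ker = W := by
    refine (hW.le_iff.mp (fun w hw => LieModuleHom.mem_ker.mpr (hzW w hw))).resolve_left
      fun h => hv ?_
    exact LieModuleHom.mem_ker.mp (h ▸ LieSubmodule.mem_top ⁅z, v⁆)
  have h2 : (f.comp f).ker = W := by
    refine (hW.le_iff.mp (fun w hw => LieModuleHom.mem_ker.mpr ?_)).resolve_left
      fun h => hv ?_
    · simp [f, hzW w hw]
    · exact LieModuleHom.mem_ker.mp (h ▸ LieSubmodule.mem_top v)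
  refine ⟨h1, ?_, ?_⟩
  · rw [← LieSubmodule.disjoint_toSubmodule, Submodule.disjoint_def]
    rintro x hx hx'
    obtain ⟨u, rfl⟩ := (LieModuleHom.mem_range f x).mp hx'
    have hu : u ∈ W := by
      rw [← h2, LieModuleHom.mem_ker]
      exact hzW _ hx
    exact hzW u hu
  · rw [codisjoint_iff]
    refine (hW.le_iff.mp le_sup_left).resolve_right fun h => hv (hzW _ ?_)
    rw [← h]
    exact (le_sup_right : f.range ≤ W ⊔ f.range) ((LieModuleHom.mem_range f _).mpr ⟨v, rfl⟩)

section AlgClosed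

variable [IsAlgClosed K] [CharZero K] [FiniteDimensional K V] {b : LinearMap.BilinForm K V}

/-- If `b` were nonzero on `W`, then `z`, which kills `W`, would be skew. An eigenvector `e` of `z`
in its image, with eigenvalue `c ≠ 0`, would then be orthogonal to `W` and to the whole
`c`-eigenspace, which together span `V`. -/
theorem HasCentralAnnihilators.isTotallyIsotropic_of_isCoatom
    (hZ : HasCentralAnnihilators K 𝔞 V) (hb : ActsConformally 𝔞 b)
    (hnd : ∀ x, (∀ y, b x y = 0) → x = 0)
    {W : LieSubmodule K 𝔞 V} (hW : IsCoatom W) :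
    IsTotallyIsotropic b (W : Submodule K V) := by
  obtain ⟨z, hz, hker, hcompl⟩ := hZ.exists_isCompl hW
  set f := centralHom (K := K) z hz
  have hzW : ∀ w, w ∈ W ↔ ⁅z, w⁆ = 0 := fun w => by
    rw [← hker, LieModuleHom.mem_ker]; rfl
  by_contra hiso
  simp only [IsTotallyIsotropic, LieSubmodule.mem_toSubmodule, not_forall] at hiso
  obtain ⟨x₀, hx₀, y₀, hy₀, hxy⟩ := hiso
  obtain ⟨η, hη⟩ := hb z
  have hη0 : η = 0 := by
    have := hη x₀ y₀
    rw [(hzW _).mp hx₀, (hzW _).mp hy₀] at this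
    simpa [hxy] using this.symm
  simp only [hη0, zero_mul] at hη
  have hne : f.range ≠ ⊥ := fun h => hW.1 (by simpa [h] using hcompl.sup_eq_top)
  have : Nontrivial (f.range : Submodule K V) :=
    (Submodule.nontrivial_iff_ne_bot).mpr (by rwa [Ne, LieSubmodule.toSubmodule_eq_bot])
  have hmaps : ∀ x ∈ (f.range : Submodule K V), LieModule.toEnd K 𝔞 V z x ∈
      (f.range : Submodule K V) := fun x hx => f.range.lie_mem hx
  obtain ⟨c, hc⟩ := Module.End.exists_eigenvalue ((LieModule.toEnd K 𝔞 V z).restrict hmaps)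
  obtain ⟨e, he⟩ := hc.exists_hasEigenvector
  have hee : ⁅z, (e : V)⁆ = c • (e : V) := congrArg Subtype.val he.apply_eq_smul
  have heW : (e : V) ∉ W := fun h => he.2 (Subtype.ext
    ((Submodule.disjoint_def.mp (LieSubmodule.disjoint_toSubmodule.mpr hcompl.disjoint)) _ h e.2))
  have hc0 : c ≠ 0 := by
    rintro rfl
    exact heW ((hzW _).mpr (by rw [hee, zero_smul]))
  let F : LieSubmodule K 𝔞 V := (f - c • LieModuleHom.id).ker
  have hF : ∀ x, x ∈ F ↔ ⁅z, x⁆ = c • x := fun x => by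
    rw [LieModuleHom.mem_ker, LieModuleHom.sub_apply, sub_eq_zero]; rfl
  have htop : W ⊔ F = ⊤ := (hW.le_iff.mp le_sup_left).resolve_right fun h =>
    heW (h ▸ (le_sup_right : F ≤ W ⊔ F) ((hF _).mpr hee))
  refine he.2 (Subtype.ext (hnd e fun y => ?_))
  obtain ⟨w, hw, u, hu, rfl⟩ := (LieSubmodule.mem_sup _ _ _).mp (htop ▸ LieSubmodule.mem_top y)
  rw [map_add]
  -- Skewness reads `c b(e, w) = 0` on `W` and `2c b(e, u) = 0` on the eigenspace.
  have h1 := hη e w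
  rw [(hzW w).mp hw, hee, map_zero, add_zero, map_smul, LinearMap.smul_apply, smul_eq_mul] at h1
  have h2 := hη e u
  rw [(hF u).mp hu, hee, map_smul, map_smul, LinearMap.smul_apply, smul_eq_mul, ← two_mul] at h2
  rw [(mul_eq_zero.mp h1).resolve_left hc0,
    (mul_eq_zero.mp ((mul_eq_zero.mp h2).resolve_left two_ne_zero)).resolve_left hc0, add_zero]

theorem HasCentralAnnihilators.isTotallyIsotropic
    (hZ : HasCentralAnnihilators K 𝔞 V) (hb : ActsConformally 𝔞 b)
    (hnd : ∀ x, (∀ y, b x y = 0) → x = 0)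
    {W : LieSubmodule K 𝔞 V} (hW : W ≠ ⊤) :
    IsTotallyIsotropic b (W : Submodule K V) := by
  obtain ⟨C, hC, hWC⟩ := (eq_top_or_exists_le_coatom W).resolve_left hW
  have := hZ.isTotallyIsotropic_of_isCoatom hb hnd hC
  exact fun x hx y hy => this x (hWC hx) y (hWC hy)

/-- Take a maximal `C ⊇ W` with complement `B`. If `W + B` is everything, modularity gives `W = C`.
Otherwise `W + B` and `C` are both isotropic, so `W` is orthogonal to `B + C = V`. -/
theorem HasCentralAnnihilators.isCoatom
    (hZ : HasCentralAnnihilators K 𝔞 V) (hb : ActsConformally 𝔞 b)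
    (hnd : ∀ x, (∀ y, b x y = 0) → x = 0)
    {W : LieSubmodule K 𝔞 V} (hW₀ : W ≠ ⊥) (hW : W ≠ ⊤) : IsCoatom W := by
  obtain ⟨C, hC, hWC⟩ := (eq_top_or_exists_le_coatom W).resolve_left hW
  obtain ⟨z, hz, -, hcompl⟩ := hZ.exists_isCompl hC
  set B := (centralHom (K := K) z hz).range
  by_cases h : W ⊔ B = ⊤
  · have : W = C := by
      apply eq_of_le_of_inf_le_of_le_sup hWC (z := B)
      · exact hcompl.inf_eq_bot.le.trans bot_le
      · exact le_top.trans h.ge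
    rwa [this]
  · have h1 := hZ.isTotallyIsotropic hb hnd h
    have h2 := hZ.isTotallyIsotropic hb hnd hC.1
    refine absurd ((LieSubmodule.eq_bot_iff _).mpr fun x hx => hnd x fun y => ?_) hW₀
    obtain ⟨u, hu, v, hv, rfl⟩ :=
      (LieSubmodule.mem_sup _ _ _).mp (hcompl.sup_eq_top ▸ LieSubmodule.mem_top y)
    rw [map_add, h2 x (hWC hx) u hu, h1 x ((le_sup_left : W ≤ W ⊔ B) hx) v
      ((le_sup_right : B ≤ W ⊔ B) hv), add_zero]

/-- A nonzero submodule strictly inside `W` would itself be maximal, forcing `W = ⊤`. -/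
theorem HasCentralAnnihilators.isAtom
    (hZ : HasCentralAnnihilators K 𝔞 V) (hb : ActsConformally 𝔞 b)
    (hnd : ∀ x, (∀ y, b x y = 0) → x = 0)
    {W : LieSubmodule K 𝔞 V} (hW₀ : W ≠ ⊥) (hW : W ≠ ⊤) : IsAtom W :=
  ⟨hW₀, fun _ hlt => by_contra fun h =>
    hW ((hZ.isCoatom hb hnd h (ne_top_of_lt hlt)).2 _ hlt)⟩

end AlgClosed

omit [LieAlgebra K 𝔞] [LieModule K 𝔞 V] in
theorem isIrreducible_of_isAtom_range {N : Type*} [AddCommGroup N] [Module K N]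
    [LieRingModule 𝔞 N] (f : N →ₗ⁅K, 𝔞⁆ V) (hf : Function.Injective f) (hat : IsAtom f.range) :
    LieModule.IsIrreducible K 𝔞 N := by
  have : Nontrivial N := by
    by_contra h
    rw [not_nontrivial_iff_subsingleton] at h
    refine hat.1 ((LieSubmodule.eq_bot_iff _).mpr fun x hx => ?_)
    obtain ⟨y, rfl⟩ := (LieModuleHom.mem_range f x).mp hx
    rw [Subsingleton.elim y 0, map_zero]
  refine LieModule.IsIrreducible.mk fun S hS => ?_
  have h : S.map f ≤ f.range := by
    rintro _ ⟨x, -, rfl⟩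
    exact (LieModuleHom.mem_range f _).mpr ⟨x, rfl⟩
  rcases hat.le_iff.mp h with h | h
  · refine absurd ((LieSubmodule.eq_bot_iff _).mpr fun x hx => hf ?_) hS
    have hx' : f x ∈ S.map f := LieSubmodule.mem_map_of_mem hx
    rw [h, LieSubmodule.mem_bot] at hx'
    rw [hx', map_zero]
  · rw [eq_top_iff]
    intro x _
    have hx : f x ∈ S.map f := h.symm ▸ (LieModuleHom.mem_range f _).mpr ⟨x, rfl⟩
    obtain ⟨y, hy, hyx⟩ := (LieSubmodule.mem_map _).mp hx
    rwa [← hf hyx]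

omit [LieAlgebra K 𝔞] [LieModule K 𝔞 V] in
theorem isIrreducible_of_isAtom {W : LieSubmodule K 𝔞 V} (hW : IsAtom W) :
    LieModule.IsIrreducible K 𝔞 W :=
  isIrreducible_of_isAtom_range W.incl Subtype.val_injective (by rwa [LieSubmodule.range_incl])

/-- Complementary totally isotropic submodules of an orthogonal representation are
contragredient. -/
theorem isContragredient_of_isCompl [FiniteDimensional K V] {b : LinearMap.BilinForm K V}
    (hnd : ∀ x, (∀ y, b x y = 0) → x = 0)
    (𝔥 : LieSubalgebra K 𝔞) (h𝔥 : ∀ a ∈ 𝔥, ∀ x y : V, b ⁅a, x⁆ y + b x ⁅a, y⁆ = 0)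
    {W₁ W₂ : LieSubmodule K 𝔞 V} (hc : IsCompl W₁ W₂)
    (h₁ : IsTotallyIsotropic b (W₁ : Submodule K V))
    (h₂ : IsTotallyIsotropic b (W₂ : Submodule K V)) : IsContragredient K 𝔥 W₁ W₂ := by
  -- An element of one summand orthogonal to the other is orthogonal to everything. Used in both
  -- orders, this bounds each dimension by the other.
  have key : ∀ W₁ W₂ : LieSubmodule K 𝔞 V, IsCompl W₁ W₂ →
      IsTotallyIsotropic b (W₁ : Submodule K V) →
      Function.Injective (b.compl₁₂ (W₁ : Submodule K V).subtype (W₂ : Submodule K V).subtype) := by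
    intro W₁ W₂ hc h₁
    rw [injective_iff_map_eq_zero]
    intro x hx
    refine Subtype.ext (hnd x fun y => ?_)
    obtain ⟨u, hu, v, hv, rfl⟩ :=
      (LieSubmodule.mem_sup _ _ _).mp (hc.sup_eq_top ▸ LieSubmodule.mem_top y)
    rw [map_add, h₁ x x.2 u hu, zero_add]
    exact LinearMap.congr_fun hx ⟨v, hv⟩
  let f : W₁ →ₗ[K] (W₂ →ₗ[K] K) :=
    b.compl₁₂ (W₁ : Submodule K V).subtype (W₂ : Submodule K V).subtype
  have hf : Function.Injective f := key W₁ W₂ hc h₁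
  have hle : Module.finrank K W₂ ≤ Module.finrank K W₁ := by
    have := LinearMap.finrank_le_finrank_of_injective (key W₂ W₁ hc.symm h₂)
    rwa [Subspace.dual_finrank_eq] at this
  have hge : Module.finrank K W₁ ≤ Module.finrank K W₂ := by
    have := LinearMap.finrank_le_finrank_of_injective hf
    rwa [Subspace.dual_finrank_eq] at this
  have hbij : Function.Bijective f := by
    refine ⟨hf, (LinearMap.injective_iff_surjective_of_finrank_eq_finrank ?_).mp hf⟩
    rw [Subspace.dual_finrank_eq]
    exact le_antisymm hge hle
  exact ⟨{ LinearEquiv.ofBijective f hbij with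
    map_lie' := by
      intro a x
      refine LinearMap.ext fun y => ?_
      exact eq_neg_of_add_eq_zero_left (h𝔥 a a.2 x y) }⟩

end Representation

/-! ### The degree `-1` part and simplicity -/

section DegreeNegOne

/-- Transitivity of a graded Lie algebra over an arbitrary field. -/
def IsTransitiveGrading {K G : Type*} [Field K] [LieRing G] [LieAlgebra K G]
    (𝒢 : ℤ → Submodule K G) : Prop :=
  ∀ p : ℤ, 0 ≤ p → ∀ X ∈ 𝒢 p, (∀ Y ∈ 𝒢 (-1), ⁅X, Y⁆ = 0) → X = 0

variable {K G 𝔞 V : Type*} [Field K] [CharZero K] [LieRing G] [LieAlgebra K G]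
  {𝒢 : ℤ → Submodule K G} [GradedLieAlgebra 𝒢] {E : G} [LieRing 𝔞] [LieAlgebra K 𝔞]
  [AddCommGroup V] [Module K V] [LieRingModule 𝔞 V] [LieModule K 𝔞 V]

/-- The linear map `j` identifies the `𝔞`-module `V` with the `𝒢 0`-module `𝒢 (-1)`. -/
structure IsDegreeNegOneModel (𝒢 : ℤ → Submodule K G) (𝔞 : Type*) [LieRing 𝔞] [LieAlgebra K 𝔞]
    [LieRingModule 𝔞 V] (j : V →ₗ[K] G) : Prop where
  injective : Function.Injective j
  range_eq : LinearMap.range j = 𝒢 (-1)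
  exists_mem : ∀ a : 𝔞, ∃ A ∈ 𝒢 0, ∀ v : V, ⁅A, j v⁆ = j ⁅a, v⁆
  exists_lie : ∀ A ∈ 𝒢 0, ∃ a : 𝔞, ∀ v : V, ⁅A, j v⁆ = j ⁅a, v⁆

variable {j : V →ₗ[K] G}

omit [CharZero K] [GradedLieAlgebra 𝒢] [LieModule K 𝔞 V] in
theorem IsDegreeNegOneModel.mem (hj : IsDegreeNegOneModel 𝒢 𝔞 j) (v : V) : j v ∈ 𝒢 (-1) :=
  hj.range_eq ▸ LinearMap.mem_range_self j v

omit [LieModule K 𝔞 V] in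
theorem IsDegreeNegOneModel.hasCentralAnnihilators [FiniteDimensional K G]
    [LieAlgebra.IsKilling K G] (hj : IsDegreeNegOneModel 𝒢 𝔞 j) (hE : IsGradingElement 𝒢 E)
    (hgen : IsNegativelyGenerated 𝒢) : HasCentralAnnihilators K 𝔞 V := by
  intro W hW
  have hlt : (W : Submodule K V).map j < 𝒢 (-1) := by
    refine lt_of_le_of_ne ?_ fun h => hW ?_
    · rintro _ ⟨w, -, rfl⟩
      exact hj.mem w
    · rw [eq_top_iff]
      intro v _
      obtain ⟨w, hw, hwv⟩ : j v ∈ (W : Submodule K V).map j := h ▸ hj.mem v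
      exact hj.injective hwv ▸ hw
  obtain ⟨z, hz, hzW, hz0, hzE⟩ := hE.exists_central _ hlt (by
    rintro x hx _ ⟨w, hw, rfl⟩
    obtain ⟨a, ha⟩ := hj.exists_lie x hx
    rw [ha]
    exact ⟨_, W.lie_mem hw, rfl⟩)
  obtain ⟨v, hv, hzv⟩ := hE.exists_lie_lie_ne_zero hgen hz hz0 hzE
  obtain ⟨a, ha⟩ := hj.exists_lie z hz
  rw [← hj.range_eq] at hv
  obtain ⟨v, rfl⟩ := hv
  refine ⟨a, fun w hw => hj.injective ?_, fun b w => hj.injective ?_, v, fun h => hzv ?_⟩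
  · rw [← ha, map_zero, hzW _ ⟨w, hw, rfl⟩]
  · obtain ⟨B, hB, hBb⟩ := hj.exists_mem b
    rw [← ha, ← hBb, ← hBb, ← ha, leibniz_lie z, hz0 B hB, zero_lie, zero_add]
  · rw [ha, ha, h, map_zero]

/-- The submodule of the model of `𝒢 (-1)` corresponding to the degree `-1` part of an ideal. -/
def IsDegreeNegOneModel.idealPart (hj : IsDegreeNegOneModel 𝒢 𝔞 j) (I : LieIdeal K G) :
    LieSubmodule K 𝔞 V where
  __ := (LieSubmodule.toSubmodule I).comap j
  lie_mem {a v} hv := by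
    obtain ⟨A, -, hA⟩ := hj.exists_mem a
    change j ⁅a, v⁆ ∈ I
    rw [← hA]
    exact I.lie_mem hv

/-- Transitivity propagates vanishing from degree `-1` to all degrees `≥ 0`. For `x` in `I` of
degree `p < 0` and `y` of degree `-p`, `p κ(x, y) = κ(E, [x, y]) = 0`, so negative degrees vanish
too. Being stable under the diagonalizable `ad E`, the ideal is spanned by its homogeneous elements.
-/
theorem IsGradingElement.ideal_eq_bot [FiniteDimensional K G] [LieAlgebra.IsKilling K G]
    (hE : IsGradingElement 𝒢 E) (htrans : IsTransitiveGrading 𝒢) {I : LieIdeal K G}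
    (hI : ∀ x ∈ I, x ∈ 𝒢 (-1) → x = 0) : I = ⊥ := by
  have hnonneg : ∀ p : ℤ, 0 ≤ p → ∀ x ∈ I, x ∈ 𝒢 p → x = 0 := by
    intro p hp
    lift p to ℕ using hp
    induction p with
    | zero =>
      refine fun x hxI hx => htrans 0 le_rfl x hx fun y hy => hI _ (lie_mem_left K G I x y hxI) ?_
      exact lie_mem_graded (by norm_num) hx hy
    | succ p ih =>
      refine fun x hxI hx => htrans _ (by positivity) x hx fun y hy =>
        ih _ (lie_mem_left K G I x y hxI) ?_
      exact lie_mem_graded (by push_cast; ring) hx hy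
  have hneg : ∀ p : ℤ, p < 0 → ∀ x ∈ I, x ∈ 𝒢 p → x = 0 := by
    intro p hp x hxI hx
    refine hE.eq_zero_of_killingForm hx fun y hy => ?_
    have h1 : ⁅x, y⁆ = 0 := hnonneg 0 le_rfl _ (lie_mem_left K G I x y hxI)
      (lie_mem_graded (by ring) hx hy)
    have h2 := LieModule.traceForm_apply_lie_apply K G G E x y
    rw [hE.lie_eq p x hx, h1, map_zero, map_smul, LinearMap.smul_apply, smul_eq_mul] at h2
    exact (mul_eq_zero.mp h2).resolve_left (by exact_mod_cast hp.ne)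
  have hhom : ∀ p : ℤ, ∀ x ∈ I, x ∈ 𝒢 p → x = 0 := fun p =>
    (lt_or_ge p 0).elim (hneg p) (hnonneg p)
  have hmaps : ∀ x ∈ LieSubmodule.toSubmodule I,
      LieAlgebra.ad K G E x ∈ LieSubmodule.toSubmodule I :=
    fun x hx => I.lie_mem hx
  have htop := Submodule.eq_iSup_inf_genEigenspace 1 hmaps hE.iSup_eigenspace
  rw [← LieSubmodule.toSubmodule_eq_bot, htop, iSup_eq_bot]
  intro μ
  rw [Submodule.eq_bot_iff]
  rintro x ⟨hxI, hxμ⟩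
  replace hxμ : ⁅E, x⁆ = μ • x := Module.End.mem_eigenspace_iff.mp hxμ
  by_contra hx0
  obtain ⟨p, hp⟩ : ∃ p, (DirectSum.decompose 𝒢 x p : G) ≠ 0 := by
    by_contra! h0
    apply hx0
    classical
    rw [← DirectSum.sum_support_decompose 𝒢 x]
    simp [h0]
  have h1 := hE.decompose_lie x p
  rw [hxμ, DirectSum.decompose_smul, DirectSum.smul_apply, Submodule.coe_smul, ← sub_eq_zero,
    ← sub_smul, smul_eq_zero, or_iff_left hp, sub_eq_zero] at h1
  exact hx0 (hhom p x hxI (hE.mem_of_lie_eq (h1 ▸ hxμ)))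

/-- The components of a homogeneous element in complementary ideals are homogeneous. -/
theorem IsGradingElement.exists_add_of_isCompl (hE : IsGradingElement 𝒢 E) {I J : LieIdeal K G}
    (hIJ : IsCompl I J) {p : ℤ} {x : G} (hx : x ∈ 𝒢 p) :
    ∃ y ∈ I, ∃ z ∈ J, y ∈ 𝒢 p ∧ z ∈ 𝒢 p ∧ x = y + z := by
  obtain ⟨y, hy, z, hz, rfl⟩ :=
    (LieSubmodule.mem_sup _ _ _).mp (hIJ.sup_eq_top ▸ LieSubmodule.mem_top x)
  have h1 := hE.lie_eq p _ hx
  rw [lie_add, smul_add] at h1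
  -- The left side lies in `I` and the right side in `J`, so both vanish.
  have h2 : ⁅E, y⁆ - (p : K) • y = (p : K) • z - ⁅E, z⁆ := by
    rw [sub_eq_sub_iff_add_eq_add, h1, add_comm]
  have h3 : ⁅E, y⁆ - (p : K) • y = 0 :=
    Submodule.disjoint_def.mp (LieSubmodule.disjoint_toSubmodule.mpr hIJ.disjoint) _
      (sub_mem (I.lie_mem hy) (Submodule.smul_mem _ _ hy))
      (h2 ▸ sub_mem (Submodule.smul_mem _ _ hz) (J.lie_mem hz))
  refine ⟨y, hy, z, hz, hE.mem_of_lie_eq (sub_eq_zero.mp h3), hE.mem_of_lie_eq ?_, rfl⟩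
  rw [h3] at h2
  exact (sub_eq_zero.mp h2.symm).symm

omit [CharZero K] in
theorem lie_eq_zero_of_disjoint_ideals {I J : LieIdeal K G} (hIJ : Disjoint I J) {x y : G}
    (hx : x ∈ I) (hy : y ∈ J) : ⁅x, y⁆ = 0 :=
  Submodule.disjoint_def.mp (LieSubmodule.disjoint_toSubmodule.mpr hIJ) _
    (lie_mem_left K G I x y hx) (J.lie_mem hy)

/-- If `𝒢` is the sum of two ideals, then the degree `-1` part of each of them is a line. -/
theorem IsDegreeNegOneModel.exists_span_singleton [IsAlgClosed K] [FiniteDimensional K G]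
    [LieAlgebra.IsKilling K G] [FiniteDimensional K V] (hj : IsDegreeNegOneModel 𝒢 𝔞 j)
    (hE : IsGradingElement 𝒢 E) (hgen : IsNegativelyGenerated 𝒢) {b : LinearMap.BilinForm K V}
    (hb : ActsConformally 𝔞 b) (hnd : ∀ x, (∀ y, b x y = 0) → x = 0) {I J : LieIdeal K G}
    (hIJ : IsCompl I J) (hI : hj.idealPart I ≠ ⊥) (hJ : hj.idealPart J ≠ ⊥) :
    ∃ x : V, ∀ v ∈ hj.idealPart I, ∃ c : K, v = c • x := by
  have hdec : ∀ v : V, ∃ x ∈ hj.idealPart I, ∃ y ∈ hj.idealPart J, v = x + y := by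
    intro v
    obtain ⟨x, hx, y, hy, hx', hy', hxy⟩ := hE.exists_add_of_isCompl hIJ (hj.mem v)
    rw [← hj.range_eq] at hx' hy'
    obtain ⟨x, rfl⟩ := hx'
    obtain ⟨y, rfl⟩ := hy'
    exact ⟨x, hx, y, hy, hj.injective (by rw [hxy, map_add])⟩
  have hItop : hj.idealPart I ≠ ⊤ := by
    intro h
    refine hJ ((LieSubmodule.eq_bot_iff _).mpr fun y hy => hj.injective ?_)
    rw [map_zero]
    have hyI : y ∈ hj.idealPart I := h ▸ LieSubmodule.mem_top y
    exact Submodule.disjoint_def.mp (LieSubmodule.disjoint_toSubmodule.mpr hIJ.disjoint) _ hyI hy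
  have hZ := hj.hasCentralAnnihilators hE hgen
  have hat := hZ.isAtom hb hnd hI hItop
  have hiso := hZ.isTotallyIsotropic hb hnd hItop
  -- Only the `I`-component `a'` of `a` acts on the `I`-part, and it kills the `J`-part. Thus `b(a'
  -- v, y) = η b(v, y)` for `y` in the `J`-part; as the `I`-part is isotropic, `a' v - η v` is
  -- orthogonal to everything.
  have hscal : ∀ a : 𝔞, ∃ c : K, ∀ v ∈ hj.idealPart I, ⁅a, v⁆ = c • v := by
    intro a
    obtain ⟨A, hA, hAa⟩ := hj.exists_mem a
    obtain ⟨B, hB, C, hC, hB0, hC0, rfl⟩ := hE.exists_add_of_isCompl hIJ hA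
    obtain ⟨a', ha'⟩ := hj.exists_lie B hB0
    obtain ⟨η, hη⟩ := hb a'
    refine ⟨η, fun v hv => ?_⟩
    have h1 : ⁅a, v⁆ = ⁅a', v⁆ := hj.injective (by
      rw [← hAa, ← ha', add_lie, ← lie_skew C, lie_eq_zero_of_disjoint_ideals hIJ.disjoint hv hC,
        neg_zero, add_zero])
    rw [h1, ← sub_eq_zero]
    refine hnd _ fun y => ?_
    obtain ⟨x, hx, y, hy, rfl⟩ := hdec y
    have h2 : ⁅a', y⁆ = 0 := hj.injective (by
      rw [← ha', lie_eq_zero_of_disjoint_ideals hIJ.disjoint hB hy, map_zero])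
    have h3 := hη v y
    rw [h2, map_zero, add_zero] at h3
    rw [map_add, hiso _ (sub_mem ((hj.idealPart I).lie_mem hv) (Submodule.smul_mem _ _ hv)) x hx,
      map_sub, LinearMap.sub_apply, h3, map_smul, LinearMap.smul_apply, smul_eq_mul, sub_self,
      add_zero]
  obtain ⟨x, hx, hx0⟩ := Submodule.exists_mem_ne_zero_of_ne_bot
    (p := (hj.idealPart I : Submodule K V)) (by rwa [Ne, LieSubmodule.toSubmodule_eq_bot])
  let N : LieSubmodule K 𝔞 V :=
    { K ∙ x with
      lie_mem := by
        intro a v hv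
        obtain ⟨c, rfl⟩ := Submodule.mem_span_singleton.mp hv
        obtain ⟨d, hd⟩ := hscal a
        change ⁅a, c • x⁆ ∈ K ∙ x
        rw [lie_smul, hd x hx]
        exact Submodule.smul_mem _ _ (Submodule.smul_mem _ _ (Submodule.mem_span_singleton_self x)) }
  have hN : N = hj.idealPart I := by
    refine (hat.le_iff.mp ?_).resolve_left fun h => hx0 ?_
    · intro v hv
      obtain ⟨c, rfl⟩ := Submodule.mem_span_singleton.mp hv
      exact Submodule.smul_mem _ _ hx
    · have hxN : x ∈ N := Submodule.mem_span_singleton_self x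
      rwa [h, LieSubmodule.mem_bot] at hxN
  refine ⟨x, fun v hv => ?_⟩
  rw [← hN] at hv
  obtain ⟨c, hc⟩ := Submodule.mem_span_singleton.mp hv
  exact ⟨c, hc.symm⟩

theorem IsDegreeNegOneModel.isSimple [IsAlgClosed K] [FiniteDimensional K G]
    [LieAlgebra.IsKilling K G] [FiniteDimensional K V] (hj : IsDegreeNegOneModel 𝒢 𝔞 j)
    (hE : IsGradingElement 𝒢 E) (hgen : IsNegativelyGenerated 𝒢) (htrans : IsTransitiveGrading 𝒢)
    (h2 : 𝒢 (-2) ≠ ⊥) {b : LinearMap.BilinForm K V}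
    (hb : ActsConformally 𝔞 b) (hnd : ∀ x, (∀ y, b x y = 0) → x = 0) :
    LieAlgebra.IsSimple K G where
  eq_bot_or_eq_top := by
    intro I
    by_contra! hI
    have hIJ := I.isCompl_killingCompl
    set J := I.killingCompl
    have hpart : ∀ I : LieIdeal K G, I ≠ ⊥ → hj.idealPart I ≠ ⊥ := by
      intro I hI h
      refine hI (hE.ideal_eq_bot htrans fun x hxI hx => ?_)
      rw [← hj.range_eq] at hx
      obtain ⟨v, rfl⟩ := hx
      have hv : v ∈ hj.idealPart I := hxI
      rw [h, LieSubmodule.mem_bot] at hv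
      rw [hv, map_zero]
    have hI0 := hpart I hI.1
    have hJ0 := hpart J fun h => hI.2 (by simpa [h] using hIJ.sup_eq_top)
    obtain ⟨x, hx⟩ := hj.exists_span_singleton hE hgen hb hnd hIJ hI0 hJ0
    obtain ⟨y, hy⟩ := hj.exists_span_singleton hE hgen hb hnd hIJ.symm hJ0 hI0
    have hlie : ∀ u ∈ 𝒢 (-1), ∀ v ∈ 𝒢 (-1), ⁅u, v⁆ = 0 := by
      intro u hu v hv
      obtain ⟨u₁, hu₁, u₂, hu₂, hu₁', hu₂', rfl⟩ := hE.exists_add_of_isCompl hIJ hu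
      obtain ⟨v₁, hv₁, v₂, hv₂, hv₁', hv₂', rfl⟩ := hE.exists_add_of_isCompl hIJ hv
      rw [← hj.range_eq] at hu₁' hu₂' hv₁' hv₂'
      obtain ⟨u₁, rfl⟩ := hu₁'
      obtain ⟨u₂, rfl⟩ := hu₂'
      obtain ⟨v₁, rfl⟩ := hv₁'
      obtain ⟨v₂, rfl⟩ := hv₂'
      rw [add_lie, lie_add, lie_add, lie_eq_zero_of_disjoint_ideals hIJ.disjoint hu₁ hv₂,
        lie_eq_zero_of_disjoint_ideals hIJ.symm.disjoint hu₂ hv₁]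
      obtain ⟨c, rfl⟩ := hx u₁ hu₁
      obtain ⟨d, rfl⟩ := hx v₁ hv₁
      obtain ⟨c', rfl⟩ := hy u₂ hu₂
      obtain ⟨d', rfl⟩ := hy v₂ hv₂
      simp
    -- With `𝒢 (-1)` abelian, it is already a subalgebra and so contains `𝒢 (-2)`, on which `E`
    -- would act both as `-1` and as `-2`.
    let S : LieSubalgebra K G :=
      { 𝒢 (-1) with
        lie_mem' := fun {u v} hu hv => by
          change ⁅u, v⁆ ∈ 𝒢 (-1)
          rw [hlie u hu v hv]
          exact zero_mem _ }
    refine h2 ((Submodule.eq_bot_iff _).mpr fun v hv => ?_)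
    have hv' : v ∈ 𝒢 (-1) := hgen S le_rfl (-2) (by norm_num) hv
    have h3 := hE.lie_eq _ v hv
    rw [hE.lie_eq _ v hv', ← sub_eq_zero, ← sub_smul] at h3
    exact (smul_eq_zero.mp h3).resolve_left (by norm_num)
  non_abelian := by
    intro h
    obtain ⟨v, hv, hv0⟩ := Submodule.exists_mem_ne_zero_of_ne_bot h2
    have h3 := hE.lie_eq _ v hv
    rw [trivial_lie_zero] at h3
    exact hv0 ((smul_eq_zero.mp h3.symm).resolve_left (by norm_num))

end DegreeNegOne

/-! ### Passage to the complexification -/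

section Complexification

variable {V V' : Type*} [AddCommGroup V] [Module ℝ V] [AddCommGroup V'] [Module ℝ V']

theorem exists_eq_tmul_add_I_tmul (x : ℂ ⊗[ℝ] V) :
    ∃ a b : V, x = (1 : ℂ) ⊗ₜ[ℝ] a + Complex.I ⊗ₜ[ℝ] b := by
  induction x using TensorProduct.induction_on with
  | zero => exact ⟨0, 0, by simp⟩
  | tmul c v =>
    refine ⟨c.re • v, c.im • v, ?_⟩
    rw [← TensorProduct.smul_tmul, ← TensorProduct.smul_tmul, ← TensorProduct.add_tmul]
    congr 1
    apply Complex.ext <;> simp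
  | add x y hx hy =>
    obtain ⟨a, b, rfl⟩ := hx
    obtain ⟨c, d, rfl⟩ := hy
    refine ⟨a + c, b + d, ?_⟩
    simp only [TensorProduct.tmul_add]
    abel

theorem tmul_add_I_tmul_inj {a b c d : V}
    (h : (1 : ℂ) ⊗ₜ[ℝ] a + Complex.I ⊗ₜ[ℝ] b = (1 : ℂ) ⊗ₜ[ℝ] c + Complex.I ⊗ₜ[ℝ] d) :
    a = c ∧ b = d := by
  have hre := congrArg (fun x => TensorProduct.lid ℝ V (Complex.reLm.rTensor V x)) h
  have him := congrArg (fun x => TensorProduct.lid ℝ V (Complex.imLm.rTensor V x)) h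
  exact ⟨by simpa using hre, by simpa using him⟩

theorem tmul_add_I_tmul_eq_zero {a b : V}
    (h : (1 : ℂ) ⊗ₜ[ℝ] a + Complex.I ⊗ₜ[ℝ] b = 0) : a = 0 ∧ b = 0 :=
  tmul_add_I_tmul_inj (by simpa using h)

theorem exists_of_mem_baseChange {W : Submodule ℝ V} {x : ℂ ⊗[ℝ] V} (hx : x ∈ W.baseChange ℂ) :
    ∃ a ∈ W, ∃ b ∈ W, x = (1 : ℂ) ⊗ₜ[ℝ] a + Complex.I ⊗ₜ[ℝ] b := by
  obtain ⟨y, rfl⟩ : x ∈ LinearMap.range (W.subtype.baseChange ℂ) := hx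
  obtain ⟨a, b, rfl⟩ := exists_eq_tmul_add_I_tmul y
  exact ⟨a, a.2, b, b.2, by simp⟩

theorem one_tmul_mem_baseChange {W : Submodule ℝ V} {a : V} :
    (1 : ℂ) ⊗ₜ[ℝ] a ∈ W.baseChange ℂ ↔ a ∈ W := by
  refine ⟨fun h => ?_, fun h => Submodule.tmul_mem_baseChange_of_mem 1 h⟩
  obtain ⟨b, hb, c, -, hbc⟩ := exists_of_mem_baseChange h
  rw [← add_zero ((1 : ℂ) ⊗ₜ[ℝ] a), ← TensorProduct.tmul_zero V Complex.I] at hbc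
  exact (tmul_add_I_tmul_inj hbc).1 ▸ hb

theorem baseChange_complex_injective {f : V →ₗ[ℝ] V'} (hf : Function.Injective f) :
    Function.Injective (f.baseChange ℂ) := by
  rw [injective_iff_map_eq_zero]
  intro x hx
  obtain ⟨a, b, rfl⟩ := exists_eq_tmul_add_I_tmul x
  rw [map_add, LinearMap.baseChange_tmul, LinearMap.baseChange_tmul] at hx
  obtain ⟨ha, hb⟩ := tmul_add_I_tmul_eq_zero hx
  rw [hf (ha.trans f.map_zero.symm), hf (hb.trans f.map_zero.symm)]
  simp

theorem baseChange_complex_separating {b : LinearMap.BilinForm ℝ V}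
    (hb : ∀ x, (∀ y, b x y = 0) → x = 0) (x : ℂ ⊗[ℝ] V)
    (hx : ∀ y, b.baseChange ℂ x y = 0) : x = 0 := by
  obtain ⟨u, v, rfl⟩ := exists_eq_tmul_add_I_tmul x
  have h : ∀ y, b u y = 0 ∧ b v y = 0 := fun y => by
    have := hx ((1 : ℂ) ⊗ₜ y)
    rw [map_add, LinearMap.add_apply, LinearMap.BilinForm.baseChange_tmul,
      LinearMap.BilinForm.baseChange_tmul] at this
    exact ⟨by simpa using congrArg Complex.re this, by simpa using congrArg Complex.im this⟩
  rw [hb u fun y => (h y).1, hb v fun y => (h y).2]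
  simp

theorem isTotallyIsotropic_of_baseChange {b : LinearMap.BilinForm ℝ V} {W : Submodule ℝ V}
    (h : IsTotallyIsotropic (b.baseChange ℂ) (W.baseChange ℂ)) : IsTotallyIsotropic b W := by
  intro x hx y hy
  have := h _ (one_tmul_mem_baseChange.mpr hx) _ (one_tmul_mem_baseChange.mpr hy)
  rw [LinearMap.BilinForm.baseChange_tmul] at this
  simpa using this

section Module

variable {𝔞 : Type*} [LieRing 𝔞] [LieAlgebra ℝ 𝔞] [LieRingModule 𝔞 V] [LieModule ℝ 𝔞 V]
  [LieRingModule 𝔞 V'] [LieModule ℝ 𝔞 V']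

/-- The complexification of a homomorphism of Lie modules. -/
noncomputable def complexifyHom (f : V →ₗ⁅ℝ, 𝔞⁆ V') : ℂ ⊗[ℝ] V →ₗ⁅ℂ, ℂ ⊗[ℝ] 𝔞⁆ ℂ ⊗[ℝ] V' where
  __ := (f : V →ₗ[ℝ] V').baseChange ℂ
  map_lie' := by
    intro a x
    -- Written with `LieModule.toEnd`, the action is linear in both arguments by the `map` lemmas.
    change (f : V →ₗ[ℝ] V').baseChange ℂ (LieModule.toEnd ℂ (ℂ ⊗[ℝ] 𝔞) (ℂ ⊗[ℝ] V) a x) =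
      LieModule.toEnd ℂ (ℂ ⊗[ℝ] 𝔞) (ℂ ⊗[ℝ] V') a ((f : V →ₗ[ℝ] V').baseChange ℂ x)
    induction a using TensorProduct.induction_on with
    | zero => simp only [map_zero, LinearMap.zero_apply]
    | add a a' h h' => simp only [map_add, LinearMap.add_apply, h, h']
    | tmul c a =>
      induction x using TensorProduct.induction_on with
      | zero => simp only [map_zero]
      | add x x' h h' => simp only [map_add, h, h']
      | tmul d x => simp

theorem baseChange_le_baseChange_iff {W W' : LieSubmodule ℝ 𝔞 V} :
    W.baseChange ℂ ≤ W'.baseChange ℂ ↔ W ≤ W' :=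
  ⟨fun h _ hx => one_tmul_mem_baseChange.mp (h (one_tmul_mem_baseChange.mpr hx)),
    fun h => Submodule.baseChange_mono ℂ h⟩

theorem baseChange_injective {W W' : LieSubmodule ℝ 𝔞 V}
    (h : W.baseChange ℂ = W'.baseChange ℂ) : W = W' :=
  le_antisymm (baseChange_le_baseChange_iff.mp h.le) (baseChange_le_baseChange_iff.mp h.ge)

theorem baseChange_ne_bot {W : LieSubmodule ℝ 𝔞 V} (h : W ≠ ⊥) : W.baseChange ℂ ≠ ⊥ :=
  fun h' => h (baseChange_injective (h'.trans (LieSubmodule.baseChange_bot ℝ ℂ 𝔞 V).symm))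

theorem baseChange_ne_top {W : LieSubmodule ℝ 𝔞 V} (h : W ≠ ⊤) : W.baseChange ℂ ≠ ⊤ :=
  fun h' => h (baseChange_injective (h'.trans (LieSubmodule.baseChange_top ℝ ℂ 𝔞 V).symm))

theorem isCoatom_of_baseChange {W : LieSubmodule ℝ 𝔞 V} (h : IsCoatom (W.baseChange ℂ)) :
    IsCoatom W := by
  refine ⟨fun hW => h.1 (by rw [hW, LieSubmodule.baseChange_top]), fun W' hlt => ?_⟩
  by_contra hW'
  exact baseChange_ne_top hW' (h.2 _ (lt_of_le_of_ne (baseChange_le_baseChange_iff.mpr hlt.le)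
    fun h' => hlt.ne (baseChange_injective h')))

/-- The module `ℂ ⊗ W` is not literally the submodule `W.baseChange ℂ`; the complexified inclusion
identifies the two. -/
theorem isIrreducible_complexify {W : LieSubmodule ℝ 𝔞 V} (h : IsAtom (W.baseChange ℂ)) :
    LieModule.IsIrreducible ℂ (ℂ ⊗[ℝ] 𝔞) (ℂ ⊗[ℝ] W) := by
  refine isIrreducible_of_isAtom_range (complexifyHom W.incl)
    (baseChange_complex_injective (f := (W.incl : W →ₗ[ℝ] V)) Subtype.val_injective) ?_
  have : (complexifyHom W.incl).range = W.baseChange ℂ := by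
    ext x
    rw [LieModuleHom.mem_range]
    rfl
  rwa [this]

theorem ActsConformally.baseChange {b : LinearMap.BilinForm ℝ V} (hb : ActsConformally 𝔞 b) :
    ActsConformally (ℂ ⊗[ℝ] 𝔞) (b.baseChange ℂ) := by
  intro a
  induction a using TensorProduct.induction_on with
  | zero => exact ⟨0, by simp⟩
  | add a a' h h' =>
    obtain ⟨η, h⟩ := h
    obtain ⟨η', h'⟩ := h'
    refine ⟨η + η', fun x y => ?_⟩
    simp only [add_lie, map_add, LinearMap.add_apply]
    linear_combination h x y + h' x y
  | tmul c a =>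
    obtain ⟨η, h⟩ := hb a
    refine ⟨c * η, fun x y => ?_⟩
    induction x using TensorProduct.induction_on with
    | zero => simp
    | add x x' h h' =>
      simp only [lie_add, map_add, LinearMap.add_apply]
      linear_combination h + h'
    | tmul d x =>
      induction y using TensorProduct.induction_on with
      | zero => simp
      | add y y' h h' =>
        simp only [lie_add, map_add]
        linear_combination h + h'
      | tmul e y =>
        have := congrArg (fun t : ℝ => (t : ℂ)) (h x y)
        push_cast at this
        simp only [LieAlgebra.ExtendScalars.bracket_tmul, LinearMap.BilinForm.baseChange_tmul,
          Algebra.smul_def, Complex.coe_algebraMap]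
        linear_combination c * d * e * this

theorem baseChange_skew {b : LinearMap.BilinForm ℝ V} {H : LieSubalgebra ℝ 𝔞}
    (hH : ∀ a ∈ H, ∀ x y : V, b ⁅a, x⁆ y + b x ⁅a, y⁆ = 0) :
    ∀ a ∈ complexification H, ∀ x y : ℂ ⊗[ℝ] V,
      b.baseChange ℂ ⁅a, x⁆ y + b.baseChange ℂ x ⁅a, y⁆ = 0 := by
  intro a ha
  let T := LieModule.toEnd ℂ (ℂ ⊗[ℝ] 𝔞) (ℂ ⊗[ℝ] V)
  have key : ∀ c : ℂ, ∀ a ∈ H, ∀ x y : ℂ ⊗[ℝ] V,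
      b.baseChange ℂ (T (c ⊗ₜ a) x) y + b.baseChange ℂ x (T (c ⊗ₜ a) y) = 0 := by
    intro c a ha x y
    induction x using TensorProduct.induction_on with
    | zero => simp only [map_zero, LinearMap.zero_apply, add_zero]
    | add x x' h h' =>
      simp only [map_add, LinearMap.add_apply]
      linear_combination h + h'
    | tmul d x =>
      induction y using TensorProduct.induction_on with
      | zero => simp only [map_zero, add_zero]
      | add y y' h h' =>
        simp only [map_add]
        linear_combination h + h'
      | tmul e y =>
        have := congrArg (fun t : ℝ => (t : ℂ)) (hH a ha x y)
        push_cast at this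
        simp only [T, LieModule.toEnd_apply_apply, LieAlgebra.ExtendScalars.bracket_tmul,
          LinearMap.BilinForm.baseChange_tmul,
          Algebra.smul_def, Complex.coe_algebraMap]
        linear_combination c * d * e * this
  obtain ⟨u, hu, v, hv, rfl⟩ := exists_of_mem_baseChange (W := H.toSubmodule) ha
  intro x y
  change b.baseChange ℂ (T _ x) y + b.baseChange ℂ x (T _ y) = 0
  simp only [map_add, LinearMap.add_apply]
  linear_combination key 1 u hu x y + key Complex.I v hv x y

end Module

section Algebra

variable {L : Type*} [LieRing L] [LieAlgebra ℝ L]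

/-- The Killing form commutes with base change, and a separating real form stays separating over
`ℂ`. -/
theorem isKilling_complexify [FiniteDimensional ℝ L] [LieAlgebra.IsKilling ℝ L] :
    LieAlgebra.IsKilling ℂ (ℂ ⊗[ℝ] L) where
  killingCompl_top_eq_bot := by
    rw [LieSubmodule.eq_bot_iff]
    intro x hx
    refine baseChange_complex_separating (b := killingForm ℝ L)
      (LieAlgebra.IsKilling.killingForm_nondegenerate ℝ L).1 x fun y => ?_
    rw [← LieModule.traceForm_baseChange, LieModule.traceForm_comm]
    exact (LieIdeal.mem_killingCompl ℂ (ℂ ⊗[ℝ] L) ⊤).mp hx y (LieSubmodule.mem_top y)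

theorem isSimple_of_complexify (h : LieAlgebra.IsSimple ℂ (ℂ ⊗[ℝ] L)) :
    LieAlgebra.IsSimple ℝ L where
  eq_bot_or_eq_top I := by
    by_contra! hI
    exact (h.eq_bot_or_eq_top (I.baseChange ℂ)).elim (baseChange_ne_bot hI.1)
      (baseChange_ne_top hI.2)
  non_abelian := by
    intro hab
    refine h.non_abelian ⟨fun x y => ?_⟩
    induction x using TensorProduct.induction_on with
    | zero => simp
    | add x x' h h' => rw [add_lie, h, h', add_zero]
    | tmul d x =>
      induction y using TensorProduct.induction_on with
      | zero => simp
      | add y y' h h' => rw [lie_add, h, h', add_zero]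
      | tmul e y => rw [LieAlgebra.ExtendScalars.bracket_tmul, trivial_lie_zero,
          TensorProduct.tmul_zero]

variable {𝔤 : ℤ → Submodule ℝ L} {E : L}

theorem IsGradingElement.complexify (hE : IsGradingElement 𝔤 E) :
    IsGradingElement (fun p => (𝔤 p).baseChange ℂ) ((1 : ℂ) ⊗ₜ[ℝ] E) where
  mem := one_tmul_mem_baseChange.mpr hE.mem
  lie_eq p x hx := by
    obtain ⟨a, ha, b, hb, rfl⟩ := exists_of_mem_baseChange hx
    simp only [lie_add, LieAlgebra.ExtendScalars.bracket_tmul, hE.lie_eq p a ha,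
      hE.lie_eq p b hb, one_mul, smul_add, Int.cast_smul_eq_zsmul, TensorProduct.tmul_smul]

/-- The complexified pieces are independent because they lie in eigenspaces of `ad (1 ⊗ E)` for
distinct eigenvalues. -/
theorem nonempty_gradedLieAlgebra_complexify [GradedLieAlgebra 𝔤] (hE : IsGradingElement 𝔤 E) :
    Nonempty (GradedLieAlgebra (fun p => (𝔤 p).baseChange ℂ : ℤ → Submodule ℂ (ℂ ⊗[ℝ] L))) := by
  classical
  let 𝒢 : ℤ → Submodule ℂ (ℂ ⊗[ℝ] L) := fun p => (𝔤 p).baseChange ℂ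
  have hind : iSupIndep 𝒢 := by
    refine ((LieAlgebra.ad ℂ (ℂ ⊗[ℝ] L) ((1 : ℂ) ⊗ₜ[ℝ] E)).eigenspaces_iSupIndep.comp
      (f := fun p : ℤ => (p : ℂ)) Int.cast_injective).mono fun p x hx => ?_
    exact Module.End.mem_eigenspace_iff.mpr (hE.complexify.lie_eq p x hx)
  have hmem : ∀ c : ℂ, ∀ a : L, c ⊗ₜ[ℝ] a ∈ ⨆ p, 𝒢 p := by
    intro c a
    rw [← DirectSum.sum_support_decompose 𝔤 a, TensorProduct.tmul_sum]
    exact Submodule.sum_mem _ fun p _ => Submodule.mem_iSup_of_mem p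
      (Submodule.tmul_mem_baseChange_of_mem c (Subtype.coe_prop _))
  have htop : ⨆ p, 𝒢 p = ⊤ := by
    rw [eq_top_iff]
    intro x _
    obtain ⟨a, b, rfl⟩ := exists_eq_tmul_add_I_tmul x
    exact add_mem (hmem _ a) (hmem _ b)
  have hint := DirectSum.isInternal_submodule_of_iSupIndep_of_iSup_eq_top hind htop
  exact ⟨{ hint.chooseDecomposition with
    bracket_mem := by
      intro p q x y hx hy
      obtain ⟨a, ha, b, hb, rfl⟩ := exists_of_mem_baseChange hx
      obtain ⟨c, hc, d, hd, rfl⟩ := exists_of_mem_baseChange hy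
      simp only [lie_add, add_lie, LieAlgebra.ExtendScalars.bracket_tmul]
      refine add_mem (add_mem ?_ ?_) (add_mem ?_ ?_) <;>
        exact Submodule.tmul_mem_baseChange_of_mem _ (SetLike.GradedBracket.bracket_mem ‹_› ‹_›) }⟩

theorem IsNegativelyGenerated.complexify (h : IsNegativelyGenerated 𝔤) :
    IsNegativelyGenerated (fun p => (𝔤 p).baseChange ℂ) := by
  intro S hS p hp x hx
  -- The real points of `S`, to which generation over `ℝ` applies.
  let S' : LieSubalgebra ℝ L :=
    { carrier := {a | (1 : ℂ) ⊗ₜ[ℝ] a ∈ S}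
      add_mem' := fun {a b} ha hb => by
        rw [Set.mem_ofPred_eq, TensorProduct.tmul_add]
        exact add_mem ha hb
      zero_mem' := by
        rw [Set.mem_ofPred_eq, TensorProduct.tmul_zero]
        exact zero_mem S
      smul_mem' := fun c a ha => by
        have : (1 : ℂ) ⊗ₜ[ℝ] (c • a) = (c : ℂ) • ((1 : ℂ) ⊗ₜ[ℝ] a) := by
          rw [TensorProduct.smul_tmul', ← TensorProduct.smul_tmul]
          simp
        rw [Set.mem_ofPred_eq, this]
        exact S.smul_mem _ ha
      lie_mem' := fun {a b} ha hb => by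
        have := S.lie_mem ha hb
        rwa [LieAlgebra.ExtendScalars.bracket_tmul, one_mul] at this }
  have hS' := h S' (fun a ha => hS (one_tmul_mem_baseChange.mpr ha)) p hp
  obtain ⟨a, ha, b, hb, rfl⟩ := exists_of_mem_baseChange hx
  refine add_mem (hS' ha) ?_
  have : Complex.I ⊗ₜ[ℝ] b = Complex.I • ((1 : ℂ) ⊗ₜ[ℝ] b) := by
    rw [TensorProduct.smul_tmul', smul_eq_mul, mul_one]
  rw [this]
  exact S.smul_mem _ (hS' hb)

theorem IsTransitiveGrading.complexify (h : IsTransitiveGrading 𝔤) :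
    IsTransitiveGrading (fun p => (𝔤 p).baseChange ℂ) := by
  intro p hp x hx hxy
  obtain ⟨a, ha, b, hb, rfl⟩ := exists_of_mem_baseChange hx
  have hab : ∀ y ∈ 𝔤 (-1), ⁅a, y⁆ = 0 ∧ ⁅b, y⁆ = 0 := fun y hy => by
    have := hxy _ (one_tmul_mem_baseChange.mpr hy)
    simp only [add_lie, LieAlgebra.ExtendScalars.bracket_tmul, mul_one] at this
    exact tmul_add_I_tmul_eq_zero this
  rw [h p hp a ha fun y hy => (hab y hy).1, h p hp b hb fun y hy => (hab y hy).2]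
  simp

theorem IsDegreeNegOneModel.complexify {𝔞 : Type*} [LieRing 𝔞] [LieAlgebra ℝ 𝔞]
    [LieRingModule 𝔞 V] [LieModule ℝ 𝔞 V] {j : V →ₗ[ℝ] L} (hj : IsDegreeNegOneModel 𝔤 𝔞 j) :
    IsDegreeNegOneModel (fun p => (𝔤 p).baseChange ℂ) (ℂ ⊗[ℝ] 𝔞) (j.baseChange ℂ) := by
  have key : ∀ (c : ℂ) (A : L) (a : 𝔞), (∀ v, ⁅A, j v⁆ = j ⁅a, v⁆) → ∀ v,
      LieAlgebra.ad ℂ (ℂ ⊗[ℝ] L) (c ⊗ₜ A) (j.baseChange ℂ v) =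
        j.baseChange ℂ (LieModule.toEnd ℂ (ℂ ⊗[ℝ] 𝔞) (ℂ ⊗[ℝ] V) (c ⊗ₜ a) v) := by
    intro c A a h v
    induction v using TensorProduct.induction_on with
    | zero => simp only [map_zero]
    | add v v' h h' => simp only [map_add, h, h']
    | tmul d v => simp [h]
  refine ⟨baseChange_complex_injective hj.injective, ?_, fun a => ?_, fun A hA => ?_⟩
  · apply le_antisymm
    · rintro _ ⟨v, rfl⟩
      obtain ⟨a, b, rfl⟩ := exists_eq_tmul_add_I_tmul v
      rw [map_add, LinearMap.baseChange_tmul, LinearMap.baseChange_tmul]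
      exact add_mem (Submodule.tmul_mem_baseChange_of_mem _ (hj.mem a))
        (Submodule.tmul_mem_baseChange_of_mem _ (hj.mem b))
    · intro x hx
      obtain ⟨a, ha, b, hb, rfl⟩ := exists_of_mem_baseChange hx
      rw [← hj.range_eq] at ha hb
      obtain ⟨a, rfl⟩ := ha
      obtain ⟨b, rfl⟩ := hb
      exact ⟨(1 : ℂ) ⊗ₜ a + Complex.I ⊗ₜ b, by simp⟩
  · obtain ⟨a, b, rfl⟩ := exists_eq_tmul_add_I_tmul a
    obtain ⟨A, hA, hAa⟩ := hj.exists_mem a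
    obtain ⟨B, hB, hBb⟩ := hj.exists_mem b
    refine ⟨(1 : ℂ) ⊗ₜ A + Complex.I ⊗ₜ B, add_mem (Submodule.tmul_mem_baseChange_of_mem _ hA)
      (Submodule.tmul_mem_baseChange_of_mem _ hB), fun v => ?_⟩
    have := congrArg₂ (· + ·) (key 1 A a hAa v) (key Complex.I B b hBb v)
    simp only [← LinearMap.add_apply, ← map_add] at this
    exact this
  · obtain ⟨A, hA', B, hB, rfl⟩ := exists_of_mem_baseChange hA
    obtain ⟨a, hAa⟩ := hj.exists_lie A hA'
    obtain ⟨b, hBb⟩ := hj.exists_lie B hB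
    refine ⟨(1 : ℂ) ⊗ₜ a + Complex.I ⊗ₜ b, fun v => ?_⟩
    have := congrArg₂ (· + ·) (key 1 A a hAa v) (key Complex.I B b hBb v)
    simp only [← LinearMap.add_apply, ← map_add] at this
    exact this

end Algebra

end Complexification

/-! ### Structure of the prolongation -/

section Prolongation

variable {M L : Type*} [LieRing M] [LieAlgebra ℝ M] [LieRing L] [LieAlgebra ℝ L]
  {𝔪 : ℤ → Submodule ℝ M} {g : LinearMap.BilinForm ℝ (𝔪 (-1))}
  {𝔤 : ℤ → Submodule ℝ L} {ι : M →ₗ⁅ℝ⁆ L}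

theorem PseudoSubriemannian.IsProlongation.exists_isGradingElement [GradedLieAlgebra 𝔪]
    [GradedLieAlgebra 𝔤]
    (h : IsProlongation 𝔪 g 𝔤 ι) : ∃ E : L, IsGradingElement 𝔤 E := by
  let δ : LieDerivation ℝ M M := LieDerivation.ofGrading 𝔪 (Int.castAddHom ℝ)
  have hδ : ∀ p : ℤ, ∀ x ∈ 𝔪 p, δ x = (p : ℝ) • x := fun p x hx =>
    LieDerivation.ofGrading_apply_apply 𝔪 (Int.castAddHom ℝ) hx
  let D : gradedDerivations 𝔪 := ⟨δ, fun p _ x hx => by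
    rw [hδ p x hx]; exact Submodule.smul_mem _ _ hx⟩
  have hD1 : ∀ x : 𝔪 (-1), ⁅D, x⁆ = -x := fun x => Subtype.ext <| by
    rw [gradedDerivations.coe_lie]
    exact (hδ (-1) x x.2).trans (by simp)
  -- `D` is `-1` on `𝔪 (-1)`, so each slot of `g` contributes `-1`, giving `η = -2`.
  have hD : D ∈ conformalDerivations 𝔪 g := ⟨-2, fun x y => by
    rw [hD1, hD1, _root_.map_neg, _root_.map_neg, LinearMap.neg_apply]
    ring⟩
  obtain ⟨E, hE0, hE⟩ := h.zero_surj D hD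
  have hneg : ∀ p : ℤ, p < 0 → ∀ x ∈ 𝔤 p, ⁅E, x⁆ = (p : ℝ) • x := by
    intro p hp x hx
    rw [← h.map_neg p hp] at hx
    obtain ⟨y, hy, rfl⟩ := hx
    exact (hE y).trans ((congrArg ι (hδ p y hy)).trans (map_smul ι _ _))
  -- By the Leibniz rule and the case of degree `p - 1`, `[E, x] - p x` commutes with `𝔤 (-1)`, so
  -- transitivity kills it.
  have hpred : ∀ p : ℤ, 0 ≤ p → (∀ x ∈ 𝔤 (p - 1), ⁅E, x⁆ = ((p - 1 : ℤ) : ℝ) • x) →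
      ∀ x ∈ 𝔤 p, ⁅E, x⁆ = (p : ℝ) • x := by
    intro p hp ih x hx
    rw [← sub_eq_zero]
    refine h.transitive p hp _ (sub_mem (lie_mem_graded (zero_add p) hE0 hx)
      (Submodule.smul_mem _ _ hx)) fun y hy => ?_
    have h1 := ih ⁅x, y⁆ (lie_mem_graded (by ring) hx hy)
    have h2 := hneg (-1) (by norm_num) y hy
    rw [leibniz_lie, h2, lie_smul] at h1
    rw [sub_lie, smul_lie, eq_sub_of_add_eq h1]
    push_cast
    module
  refine ⟨E, hE0, fun p => ?_⟩
  rcases lt_or_ge p 0 with hp | hp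
  · exact hneg p hp
  · lift p to ℕ using hp
    induction p with
    | zero => exact hpred 0 le_rfl (hneg _ (by norm_num))
    | succ p ih =>
      refine hpred _ (by positivity) ?_
      have hp : ((p + 1 : ℕ) : ℤ) - 1 = p := by push_cast; ring
      rw [hp]
      exact ih

theorem PseudoSubriemannian.IsProlongation.isNegativelyGenerated (h : IsProlongation 𝔪 g 𝔤 ι)
    (hgen : LieSubalgebra.lieSpan ℝ M (𝔪 (-1) : Set M) = ⊤) : IsNegativelyGenerated 𝔤 := by
  intro S hS p hp x hx
  have htop : S.comap ι = ⊤ := by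
    rw [eq_top_iff, ← hgen, LieSubalgebra.lieSpan_le]
    intro y hy
    refine hS ?_
    rw [← h.map_neg (-1) (by norm_num)]
    exact ⟨y, hy, rfl⟩
  rw [← h.map_neg p hp] at hx
  obtain ⟨y, -, rfl⟩ := hx
  have hy : y ∈ S.comap ι := htop ▸ LieSubalgebra.mem_top y
  exact hy

theorem PseudoSubriemannian.IsProlongation.isDegreeNegOneModel (h : IsProlongation 𝔪 g 𝔤 ι) :
    IsDegreeNegOneModel 𝔤 (conformalDerivations 𝔪 g) ((ι : M →ₗ[ℝ] L) ∘ₗ (𝔪 (-1)).subtype) where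
  injective := h.injective.comp Subtype.val_injective
  range_eq := by
    rw [LinearMap.range_comp, Submodule.range_subtype, h.map_neg (-1) (by norm_num)]
  exists_mem D := by
    obtain ⟨A, hA, hAD⟩ := h.zero_surj D.1 D.2
    exact ⟨A, hA, fun v => hAD v⟩
  exists_lie A hA := by
    obtain ⟨D, hD, hAD⟩ := h.zero_acts A hA
    exact ⟨⟨D, hD⟩, fun v => hAD v⟩

end Prolongation

/-! ### The main theorem -/

theorem proposition5p1
    {M : Type*} [LieRing M] [LieAlgebra ℝ M] (𝔪 : ℤ → Submodule ℝ M) [GradedLieAlgebra 𝔪]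
    (g : LinearMap.BilinForm ℝ (𝔪 (-1))) (hg : IsConformalFGLA 𝔪 g)
    {L : Type*} [LieRing L] [LieAlgebra ℝ L] (𝔤 : ℤ → Submodule ℝ L) [GradedLieAlgebra 𝔤]
    (ι : M →ₗ⁅ℝ⁆ L) (hprol : IsProlongation 𝔪 g 𝔤 ι)
    -- `(𝔪, [g])` is of semisimple type
    (hfin : FiniteDimensional ℝ L) (hss : LieAlgebra.IsSemisimple ℝ L) :
    -- (1) if the complexification of `𝔪 (-1)` is reducible
    (¬ LieModule.IsIrreducible ℂ (ℂ ⊗[ℝ] conformalDerivations 𝔪 g) (ℂ ⊗[ℝ] 𝔪 (-1)) →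
      ∃ W₁ W₂ : LieSubmodule ℂ (ℂ ⊗[ℝ] conformalDerivations 𝔪 g) (ℂ ⊗[ℝ] 𝔪 (-1)),
        IsCompl W₁ W₂ ∧
        IsTotallyIsotropic (g.baseChange ℂ) (W₁ : Submodule ℂ (ℂ ⊗[ℝ] 𝔪 (-1))) ∧
        IsTotallyIsotropic (g.baseChange ℂ) (W₂ : Submodule ℂ (ℂ ⊗[ℝ] 𝔪 (-1))) ∧
        IsContragredient ℂ (complexification (isometricDerivations 𝔪 g)) W₁ W₂ ∧
        LieModule.IsIrreducible ℂ (ℂ ⊗[ℝ] conformalDerivations 𝔪 g) W₁ ∧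
        LieModule.IsIrreducible ℂ (ℂ ⊗[ℝ] conformalDerivations 𝔪 g) W₂) ∧
    -- (2) if `𝔪 (-1)` is reducible
    (¬ LieModule.IsIrreducible ℝ (conformalDerivations 𝔪 g) (𝔪 (-1)) →
      ∃ W₁ W₂ : LieSubmodule ℝ (conformalDerivations 𝔪 g) (𝔪 (-1)),
        IsCompl W₁ W₂ ∧
        IsTotallyIsotropic g (W₁ : Submodule ℝ (𝔪 (-1))) ∧
        IsTotallyIsotropic g (W₂ : Submodule ℝ (𝔪 (-1))) ∧
        IsContragredient ℝ (isometricDerivations 𝔪 g) W₁ W₂ ∧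
        LieModule.IsIrreducible ℂ (ℂ ⊗[ℝ] conformalDerivations 𝔪 g) (ℂ ⊗[ℝ] W₁) ∧
        LieModule.IsIrreducible ℂ (ℂ ⊗[ℝ] conformalDerivations 𝔪 g) (ℂ ⊗[ℝ] W₂)) ∧
    -- (3) the prolongation
    IsSGLAOfClassB 𝔤 := by
  have := hg.finiteDimensional
  -- Trivial radical makes the Killing form nondegenerate in characteristic zero.
  have := LieAlgebra.IsSemisimple.instHasTrivialRadical (R := ℝ) (L := L)
  have hnd := hg.nondegenerate.1
  have hb : ActsConformally (conformalDerivations 𝔪 g) g := fun D => D.2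
  obtain ⟨E, hE⟩ := hprol.exists_isGradingElement
  have hgen := hprol.isNegativelyGenerated hg.generated
  have htrans : IsTransitiveGrading 𝔤 := hprol.transitive
  have hj := hprol.isDegreeNegOneModel
  have hZ := hj.hasCentralAnnihilators hE hgen
  have : LieAlgebra.IsKilling ℂ (ℂ ⊗[ℝ] L) := isKilling_complexify
  obtain ⟨hgr⟩ := nonempty_gradedLieAlgebra_complexify hE
  have hZc := hj.complexify.hasCentralAnnihilators hE.complexify hgen.complexify
  have hbc := hb.baseChange
  have hndc := baseChange_complex_separating hnd
  have : Nontrivial (𝔪 (-1)) := Submodule.nontrivial_iff_ne_bot.mpr hg.ne_bot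
  refine ⟨fun hred => ?_, fun hred => ?_, ⟨⟨inferInstance⟩, ?_⟩, ⟨hgr⟩, ?_⟩
  · have : Nontrivial (ℂ ⊗[ℝ] 𝔪 (-1)) := inferInstance
    obtain ⟨W, hW0, hW⟩ : ∃ W : LieSubmodule ℂ (ℂ ⊗[ℝ] conformalDerivations 𝔪 g)
        (ℂ ⊗[ℝ] 𝔪 (-1)), W ≠ ⊥ ∧ W ≠ ⊤ := by
      by_contra! h
      exact hred (LieModule.IsIrreducible.mk h)
    obtain ⟨z, hz, -, hc⟩ := hZc.exists_isCompl (hZc.isCoatom hbc hndc hW0 hW)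
    set B := (centralHom (K := ℂ) z hz).range
    have hB0 : B ≠ ⊥ := fun h => hW (by simpa [h] using hc.sup_eq_top)
    have hB : B ≠ ⊤ := fun h => hW0 (by simpa [h] using hc.inf_eq_bot)
    have h1 := hZc.isTotallyIsotropic hbc hndc hW
    have h2 := hZc.isTotallyIsotropic hbc hndc hB
    have hskew := baseChange_skew (b := g) (H := isometricDerivations 𝔪 g) fun D hD => hD
    have hcon := isContragredient_of_isCompl hndc (complexification (isometricDerivations 𝔪 g))
      hskew hc h1 h2
    exact ⟨W, B, hc, h1, h2, hcon,
      isIrreducible_of_isAtom (hZc.isAtom hbc hndc hW0 hW),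
      isIrreducible_of_isAtom (hZc.isAtom hbc hndc hB0 hB)⟩
  · obtain ⟨W, hW0, hW⟩ : ∃ W : LieSubmodule ℝ (conformalDerivations 𝔪 g) (𝔪 (-1)),
        W ≠ ⊥ ∧ W ≠ ⊤ := by
      by_contra! h
      exact hred (LieModule.IsIrreducible.mk h)
    have hat : ∀ W : LieSubmodule ℝ (conformalDerivations 𝔪 g) (𝔪 (-1)), W ≠ ⊥ → W ≠ ⊤ →
        IsAtom (W.baseChange ℂ) := fun W h h' =>
      hZc.isAtom hbc hndc (baseChange_ne_bot h) (baseChange_ne_top h')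
    have hiso : ∀ W : LieSubmodule ℝ (conformalDerivations 𝔪 g) (𝔪 (-1)), W ≠ ⊤ →
        IsTotallyIsotropic g (W : Submodule ℝ (𝔪 (-1))) := fun W h =>
      isTotallyIsotropic_of_baseChange (hZc.isTotallyIsotropic hbc hndc (baseChange_ne_top h))
    -- Maximality of `W` is known only through its complexification, where eigenvalues exist; the
    -- complement is then built from a real `z`, so that it is a real submodule.
    obtain ⟨z, hz, -, hc⟩ := hZ.exists_isCompl (isCoatom_of_baseChange
      (hZc.isCoatom hbc hndc (baseChange_ne_bot hW0) (baseChange_ne_top hW)))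
    set B := (centralHom (K := ℝ) z hz).range
    have hB0 : B ≠ ⊥ := fun h => hW (by simpa [h] using hc.sup_eq_top)
    have hB : B ≠ ⊤ := fun h => hW0 (by simpa [h] using hc.inf_eq_bot)
    exact ⟨W, B, hc, hiso W hW, hiso B hB,
      isContragredient_of_isCompl hnd (isometricDerivations 𝔪 g) (fun D hD => hD) hc
        (hiso W hW) (hiso B hB),
      isIrreducible_complexify (hat W hW0 hW), isIrreducible_complexify (hat B hB0 hB)⟩
  -- Both remaining goals follow from simplicity over `ℂ`, the stronger of the two.
  all_goals
    have hsimple : LieAlgebra.IsSimple ℂ (ℂ ⊗[ℝ] L) := by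
      refine hj.complexify.isSimple hE.complexify hgen.complexify htrans.complexify ?_ hbc hndc
      obtain ⟨x, hx, hx0⟩ := Submodule.exists_mem_ne_zero_of_ne_bot hg.ne_bot_two
      have hιx : ι x ∈ 𝔤 (-2) := hprol.map_neg (-2) (by norm_num) ▸ ⟨x, hx, rfl⟩
      intro hbot
      have h1 : (1 : ℂ) ⊗ₜ[ℝ] ι x ∈ (𝔤 (-2)).baseChange ℂ := one_tmul_mem_baseChange.mpr hιx
      rw [hbot, Submodule.mem_bot] at h1
      have h2 : (1 : ℂ) ⊗ₜ[ℝ] ι x + Complex.I ⊗ₜ[ℝ] (0 : L) = 0 := by rw [h1]; simp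
      exact hx0 (hprol.injective ((tmul_add_I_tmul_eq_zero h2).1.trans (map_zero ι).symm))
  · exact isSimple_of_complexify hsimple
  · exact hsimple
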